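/- Let $\mathbb K$ be a commutative ring, $G$ a group, and $S_1,\dots,S_m\subset G$ ($m\ge 1$) subgroups with $S_i\cap S_j=\{1\}$ for $i\neq j$; put $\mathcal S=\bigcup_k S_k$. *Conventions.* For a left $\mathbb K[G]$-module $M$ let $C_*(G;M)$ and $C^*(G;M)$ be the inhomogeneous bar complexes. Relative homology $H_n(G,\mathcal S;M)$ is the homology of $C_*(G;M)/\sum_k C_*(S_k;M)$, and $H^n(G,\mathcal S;M)$ is the cohomology of the subcomplex $C^*(G,\mathcal S;M)\subset C^*(G;M)$ of cochains $f$ with $f(l_1,\dots,l_n)=0$ whenever $l_1,\dots,l_n$ all lie in one $S_k$. The pair $(G,\mathcal S)$ is a $\mathbb K$-$\mathrm{PD}_2$ pair if there is $e\in H_2(G,\mathcal S;\mathbb K)$ (trivial coefficients) such that the cap products $e\cap\bullet: H^i(G,\mathcal S;M)\to H_{2-i}(G;M)$ and $e\cap\bullet: H^i(G;M)\to H_{2-i}(G,\mathcal S;M)$ are isomorphisms for every left $\mathbb K[G]$-module $M$ and all integers $i$ (groups in negative degrees are $0$). A Fox pairing is a $\mathbb K$-bilinear map $\eta:\mathbb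 K[G]\times\mathbb K[G]\to\mathbb K[G]$ with $\eta(a_1a_2,b)=\eta(a_1,b)\,\mathrm{aug}(a_2)+a_1\eta(a_2,b)$ and $\eta(a,b_1b_2)=\eta(a,b_1)b_2+\mathrm{aug}(b_1)\eta(a,b_2)$, where $\mathrm{aug}:\mathbb K[G]\to\mathbb K$ is the augmentation. Let $B=H^1(G;\mathbb K[G])$ be the $\mathbb K$-module of maps $f:G\to\mathbb K[G]$ with $f(gh)=f(g)h+f(h)$ modulo the maps $g\mapsto c(1-g)$, $c\in\mathbb K[G]$, with the left $G$-action $(x\cdot f)(g)=x f(g)$. A Fox pairing $\eta$ *represents a basis* of $H^1(G,\mathcal S;B)$ if $g\mapsto[\eta(g,\bullet)]\in B$ is a relative $1$-cocycle, i.e. lies in $Z^1(G,\mathcal S;B)$, and $k\mapsto k[\eta]$ is a bijection $\mathbb K\to H^1(G,\mathcal S;B)$ (so that $H^1(G,\mathcal S;B)\cong\mathbb K$). **Theorem.** Let $(G,\mathcal S)$ be a $\mathbb K$-$\mathrm{PD}_2$ pair. 1. There is a Fox pairing $\eta$ which represents a basis of $H^1(G,\mathcal S;B)\cong\mathbb K$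 and for which there are uniquely determined $a_s\in\mathbb K[G]$ $(s\in\mathcal S)$ with $$\eta(s,g)=a_s(1-g)\qquad\text{for all } s\in\mathcal S,\ g\in G .$$ Moreover $\eta$ is the only Fox pairing with these values on $\mathcal S\times G$. 2. If $\mathbb K$ is a field and $\mathcal S=\langle\zeta\rangle\cong\mathbb Z$, there is exactly one Fox pairing $\eta$ with $\eta(\zeta,g)=1-g$ for all $g\in G$, and this $\eta$ represents a basis of $H^1(G,\mathcal S;B)\cong\mathbb K$. -/

import Mathlib

open MonoidAlgebra

universe u v w

noncomputable section

namespace FoxPD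

/-! Inhomogeneous (co)chains, relative to a finite family of subgroups.
A left `K[G]`-module is a `K`-module `M` with a representation `ρ : Representation K G M`. -/

section Complexes

variable {K : Type u} {G : Type v} {M : Type w} {ι : Type*}
variable [CommRing K] [Group G] [AddCommGroup M] [Module K M]

/-- The boundary `C_{n+1}(G; M) → C_n(G; M)`: it sends `m ⊗ [g₀|…|gₙ]` to
`g₀⁻¹ m ⊗ [g₁|…|gₙ] + ∑_{j<n} (-1)^{j+1} m ⊗ [g₀|…|gⱼgⱼ₊₁|…|gₙ] + (-1)^{n+1} m ⊗ [g₀|…|gₙ₋₁]`. -/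
def chainD (ρ : Representation K G M) (n : ℕ) :
    ((Fin (n + 1) → G) →₀ M) →ₗ[K] ((Fin n → G) →₀ M) :=
  Finsupp.lsum K fun g =>
    Finsupp.lsingle (fun i => g i.succ) ∘ₗ ρ (g 0)⁻¹ +
      ∑ j : Fin (n + 1), (-1 : K) ^ ((j : ℕ) + 1) • Finsupp.lsingle (Fin.contractNth j (· * ·) g)

/-- The coboundary `Cⁿ(G; M) → Cⁿ⁺¹(G; M)` on functions `Gⁿ → M`. -/
def cochainD (ρ : Representation K G M) (n : ℕ) :
    ((Fin n → G) → M) →ₗ[K] ((Fin (n + 1) → G) → M) :=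
  LinearMap.pi fun g =>
    ρ (g 0) ∘ₗ LinearMap.proj (fun i => g i.succ) +
      ∑ j : Fin (n + 1), (-1 : K) ^ ((j : ℕ) + 1) • LinearMap.proj (Fin.contractNth j (· * ·) g)

variable (K M) in
/-- The submodule `∑ₖ C_n(S_k; M)` of `C_n(G; M)`. -/
def chainSub (S : ι → Subgroup G) (n : ℕ) : Submodule K ((Fin n → G) →₀ M) :=
  ⨆ k, Finsupp.supported M K {g : Fin n → G | ∀ i, g i ∈ S k}

variable (K M) in
/-- `Cⁿ(G, 𝒮; M)`: the cochains that vanish on `(l₁, …, lₙ)` whenever all `lᵢ` lie in one `S_k`. -/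
def relCochains (S : ι → Subgroup G) (n : ℕ) : Submodule K ((Fin n → G) → M) where
  carrier := {f | ∀ k, ∀ g : Fin n → G, (∀ i, g i ∈ S k) → f g = 0}
  add_mem' := fun ha hb k g hg => by simp [ha k g hg, hb k g hg]
  zero_mem' := fun _ _ _ => rfl
  smul_mem' := fun c _ ha k g hg => by simp [ha k g hg]

/-- Chains whose class in `C_n(G; M) / ∑ₖ C_n(S_k; M)` is a cycle. -/
def relCycles (ρ : Representation K G M) (S : ι → Subgroup G) :
    (n : ℕ) → Submodule K ((Fin n → G) →₀ M)
  | 0 => ⊤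
  | n + 1 => (chainSub K M S n).comap (chainD ρ n)

/-- Chains whose class in `C_n(G; M) / ∑ₖ C_n(S_k; M)` is a boundary. -/
def relBoundaries (ρ : Representation K G M) (S : ι → Subgroup G) (n : ℕ) :
    Submodule K ((Fin n → G) →₀ M) :=
  LinearMap.range (chainD ρ n) ⊔ chainSub K M S n

/-- The relative homology `H_n(G, 𝒮; M)`, that is, the `n`-th homology of the quotient complex
`C_*(G; M) / ∑ₖ C_*(S_k; M)`. -/
abbrev RelHomology (ρ : Representation K G M) (S : ι → Subgroup G) (n : ℕ) : Type _ :=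
  relCycles ρ S n ⧸ (relBoundaries ρ S n).submoduleOf (relCycles ρ S n)

/-- The relative cocycles `Zⁿ(G, 𝒮; M)`. -/
def relCocycles (ρ : Representation K G M) (S : ι → Subgroup G) (n : ℕ) :
    Submodule K ((Fin n → G) → M) :=
  relCochains K M S n ⊓ LinearMap.ker (cochainD ρ n)

/-- The relative coboundaries `Bⁿ(G, 𝒮; M)`. -/
def relCoboundaries (ρ : Representation K G M) (S : ι → Subgroup G) :
    (n : ℕ) → Submodule K ((Fin n → G) → M)
  | 0 => ⊥
  | n + 1 => (relCochains K M S n).map (cochainD ρ n)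

/-- The relative cohomology `Hⁿ(G, 𝒮; M)`. -/
abbrev RelCohomology (ρ : Representation K G M) (S : ι → Subgroup G) (n : ℕ) : Type _ :=
  relCocycles ρ S n ⧸ (relCoboundaries ρ S n).submoduleOf (relCocycles ρ S n)

variable (G) in
/-- The empty family of subgroups. (Co)homology relative to it is the absolute (co)homology. -/
abbrev noSubgroup : Empty → Subgroup G := Empty.elim

end Complexes

section Cap

variable {K : Type u} {G : Type v} {M : Type w}
variable [CommRing K] [Group G] [AddCommGroup M] [Module K M]

/-- The first `i` entries of a tuple of length `n = i + j`. -/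
def front {i j n : ℕ} (h : i + j = n) (g : Fin n → G) : Fin i → G :=
  fun a => g ⟨a, by omega⟩

/-- The last `j` entries of a tuple of length `n = i + j`. -/
def back {i j n : ℕ} (h : i + j = n) (g : Fin n → G) : Fin j → G :=
  fun a => g ⟨i + a, by omega⟩

/-- The cap product on (co)chains, `[g₁|…|gₙ] ∩ f = (g₁⋯gᵢ)⁻¹ f(g₁,…,gᵢ) ⊗ [gᵢ₊₁|…|gₙ]`. -/
def cap (ρ : Representation K G M) {i j n : ℕ} (h : i + j = n) :
    ((Fin n → G) →₀ K) →ₗ[K] ((Fin i → G) → M) →ₗ[K] ((Fin j → G) →₀ M) :=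
  Finsupp.linearCombination K fun g =>
    Finsupp.lsingle (back h g) ∘ₗ ρ (Fin.partialProd g ⟨i, by omega⟩)⁻¹ ∘ₗ
      LinearMap.proj (front h g)

theorem cap_single (ρ : Representation K G M) {i j n : ℕ} (h : i + j = n) (g : Fin n → G) (c : K)
    (f : (Fin i → G) → M) :
    cap ρ h (Finsupp.single g c) f =
      c • Finsupp.single (back h g) (ρ (Fin.partialProd g ⟨i, by omega⟩)⁻¹ (f (front h g))) := by
  simp [cap]

theorem chainD_single (ρ : Representation K G M) (n : ℕ) (g : Fin (n + 1) → G) (m : M) :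
    chainD ρ n (Finsupp.single g m) =
      Finsupp.single (fun i => g i.succ) (ρ (g 0)⁻¹ m) +
        ∑ j : Fin (n + 1),
          (-1 : K) ^ ((j : ℕ) + 1) • Finsupp.single (Fin.contractNth j (· * ·) g) m := by
  simp [chainD, LinearMap.sum_apply]

theorem cochainD_apply (ρ : Representation K G M) (n : ℕ) (f : (Fin n → G) → M)
    (g : Fin (n + 1) → G) :
    cochainD ρ n f g = ρ (g 0) (f fun i => g i.succ) +
      ∑ j : Fin (n + 1), (-1 : K) ^ ((j : ℕ) + 1) • f (Fin.contractNth j (· * ·) g) := by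
  simp [cochainD, LinearMap.sum_apply]

/-- The Leibniz rule for the cap product. -/
theorem cap_leibniz (ρ : Representation K G M) {i j n : ℕ} (h : i + j = n)
    (c : (Fin (n + 1) → G) →₀ K) (f : (Fin i → G) → M) :
    cap ρ h (chainD (Representation.trivial K G K) n c) f =
      cap ρ (show (i + 1) + j = n + 1 by omega) c (cochainD ρ i f) +
        (-1 : K) ^ i • chainD ρ j (cap ρ (show i + (j + 1) = n + 1 by omega) c f) := by
  have hsplit : ∀ F : Fin (n + 1) → ((Fin j → G) →₀ M), ∑ t, F t =
      ∑ a : Fin i, F ⟨a, by omega⟩ + ∑ b : Fin (j + 1), F ⟨i + b, by omega⟩ := by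
    subst h
    exact fun F => Fin.sum_univ_add (a := i) (b := j + 1) F
  induction c using Finsupp.induction_linear with
  | zero => simp
  | add a b ha hb =>
    simp only [map_add, LinearMap.add_apply, ha, hb, smul_add]
    abel
  | single g r =>
    have key : ∀ x : K, r • x = x * r := fun x => by simp [mul_comm]
    have e0 : back h (fun a => g a.succ) =
        back (show (i + 1) + j = n + 1 by omega) g := by
      funext a; simp only [back]; congr 1; ext; simp; omega
    have e0' : (fun a => back (show i + (j + 1) = n + 1 by omega) g a.succ) =
        back (show (i + 1) + j = n + 1 by omega) g := by
      funext a; simp only [back]; congr 1; ext; simp; omega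
    have e1 : front h (fun a => g a.succ) =
        fun a => front (show (i + 1) + j = n + 1 by omega) g a.succ := by
      funext a; simp only [front]; congr 1
    have e2 : Fin.contractNth (Fin.last i) (· * ·)
        (front (show (i + 1) + j = n + 1 by omega) g) =
        front (show i + (j + 1) = n + 1 by omega) g := by
      funext a
      rw [Fin.contractNth_apply_of_lt _ _ _ _ (by simp)]
      rfl
    have p1 : Fin.partialProd g ⟨i + 1, by omega⟩ =
        g 0 * Fin.partialProd (fun a => g a.succ) ⟨i, by omega⟩ :=
      Fin.partialProd_succ' g ⟨i, by omega⟩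
    have p2 : Fin.partialProd g ⟨i + 1, by omega⟩ =
        Fin.partialProd g ⟨i, by omega⟩ *
          back (show i + (j + 1) = n + 1 by omega) g 0 :=
      Fin.partialProd_succ g ⟨i, by omega⟩
    have c1 : ∀ a : Fin i,
        back h
          (Fin.contractNth (⟨a, by omega⟩ : Fin (n + 1)) (· * ·) g) =
        back (show (i + 1) + j = n + 1 by omega) g := by
      intro a; funext b
      simp only [back]
      rw [Fin.contractNth_apply_of_gt _ _ _ _ (by simp only []; omega)]
      congr 1; ext; simp; omega
    have c2 : ∀ a : Fin i,
        front h
          (Fin.contractNth (⟨a, by omega⟩ : Fin (n + 1)) (· * ·) g) =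
        Fin.contractNth a.castSucc (· * ·)
          (front (show (i + 1) + j = n + 1 by omega) g) := by
      intro a; funext b
      simp only [front, Fin.contractNth]
      simp
    have c3 : ∀ a : Fin i,
        Fin.partialProd
          (Fin.contractNth (⟨a, by omega⟩ : Fin (n + 1)) (· * ·) g) ⟨i, by omega⟩ =
        Fin.partialProd g ⟨i + 1, by omega⟩ := by
      intro a
      rw [Fin.partialProd_contractNth]
      simp only [Function.comp]
      congr 1
      rw [Fin.succAbove_of_le_castSucc _ _ (by simp [Fin.le_def])]
      rfl
    have d1 : ∀ b : Fin (j + 1),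
        back h
          (Fin.contractNth (⟨i + b, by omega⟩ : Fin (n + 1)) (· * ·) g) =
        Fin.contractNth b (· * ·) (back (show i + (j + 1) = n + 1 by omega) g) := by
      intro b; funext a
      simp only [back, Fin.contractNth]
      simp [add_assoc]
    have d2 : ∀ b : Fin (j + 1),
        front h
          (Fin.contractNth (⟨i + b, by omega⟩ : Fin (n + 1)) (· * ·) g) =
        front (show i + (j + 1) = n + 1 by omega) g := by
      intro b; funext a
      simp only [front]
      rw [Fin.contractNth_apply_of_lt _ _ _ _ (by simp only []; omega)]
      rfl
    have d3 : ∀ b : Fin (j + 1),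
        Fin.partialProd
          (Fin.contractNth (⟨i + b, by omega⟩ : Fin (n + 1)) (· * ·) g) ⟨i, by omega⟩ =
        Fin.partialProd g ⟨i, by omega⟩ := by
      intro b
      rw [Fin.partialProd_contractNth]
      simp only [Function.comp]
      congr 1
      rw [Fin.succAbove_of_castSucc_lt _ _ (by simp [Fin.lt_def])]
      rfl
    have g0 : front (show (i + 1) + j = n + 1 by omega) g 0 = g 0 := rfl
    rw [chainD_single, map_add, LinearMap.add_apply, cap_single, cap_single, cap_single,
      LinearMap.map_smul, chainD_single, cochainD_apply, map_sum, LinearMap.sum_apply]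
    simp only [map_smul, LinearMap.smul_apply, cap_single]
    rw [Fin.sum_univ_castSucc (n := i)]
    rw [hsplit]
    simp only [c1, c2, c3, d1, d2, d3, e0, e0', e1, e2, g0]
    have q1 : ∀ x : M, ρ (Fin.partialProd g ⟨i + 1, by omega⟩)⁻¹ (ρ (g 0) x) =
        ρ (Fin.partialProd (fun a => g a.succ) ⟨i, by omega⟩)⁻¹ x := by
      intro x
      rw [p1, ← Module.End.mul_apply, ← map_mul]
      simp
    have q2 : ∀ x : M, ρ (back (show i + (j + 1) = n + 1 by omega) g 0)⁻¹
        (ρ (Fin.partialProd g ⟨i, by omega⟩)⁻¹ x) =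
        ρ (Fin.partialProd g ⟨i + 1, by omega⟩)⁻¹ x := by
      intro x
      rw [p2, ← Module.End.mul_apply, ← map_mul]
      simp
    simp only [map_add, map_sum, map_smul, q1, q2, Finsupp.single_add, smul_add,
      Finsupp.single_finsetSum, ← Finsupp.smul_single, Finset.smul_sum, smul_smul]
    have r1 : ∀ x : ℕ, r * (-1 : K) ^ (x + 1) = (-1) ^ (x + 1) * r := fun x => mul_comm _ _
    have r2 : ∀ x : ℕ, (-1 : K) ^ i * ((-1) ^ (x + 1) * r) = (-1) ^ (i + x + 1) * r :=
      fun x => by ring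
    have r3 : (-1 : K) ^ (i + 1) * r = -((-1) ^ i * r) := by ring
    simp only [r1, r2, r3, Fin.val_last, Fin.val_castSucc, neg_smul,
      Representation.isTrivial_def, LinearMap.id_apply]
    abel

section CapHom

variable {ι κ τ : Type*} {S : ι → Subgroup G} {T : κ → Subgroup G} {U : τ → Subgroup G}

/-- If each `S_k` is one of the `T_l` or one of the `U_l`, the cap product pairs chains of `𝒮` and
cochains vanishing on `𝒯` to chains of `𝒰`. -/
theorem cap_mem_chainSub (hSTU : ∀ k, (∃ l, S k = T l) ∨ ∃ l, S k = U l)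
    (ρ : Representation K G M) {i j n : ℕ} (h : i + j = n)
    {c : (Fin n → G) →₀ K} (hc : c ∈ chainSub K K S n)
    {f : (Fin i → G) → M} (hf : f ∈ relCochains K M T i) :
    cap ρ h c f ∈ chainSub K M U j := by
  suffices chainSub K K S n ≤ (chainSub K M U j).comap ((cap ρ h).flip f) from this hc
  refine iSup_le fun k => ?_
  rw [Finsupp.supported_eq_span_single, Submodule.span_le]
  rintro _ ⟨g, hg, rfl⟩
  simp only [SetLike.mem_coe, Submodule.mem_comap, LinearMap.flip_apply, cap_single]
  rcases hSTU k with ⟨l, hl⟩ | ⟨l, hl⟩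
  · rw [hf l (front h g) (fun a => hl ▸ hg _)]
    simp
  · refine Submodule.smul_mem _ _ (Submodule.mem_iSup_of_mem l ?_)
    exact Finsupp.single_mem_supported K _ (fun a => hl ▸ hg _)

theorem cap_mem_relCycles (hSTU : ∀ k, (∃ l, S k = T l) ∨ ∃ l, S k = U l)
    (ρ : Representation K G M) {i j n : ℕ} (h : i + j = n)
    {e : (Fin n → G) →₀ K} (he : e ∈ relCycles (Representation.trivial K G K) S n)
    {f : (Fin i → G) → M} (hf : f ∈ relCocycles ρ T i) :
    cap ρ h e f ∈ relCycles ρ U j := by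
  cases j with
  | zero => exact Submodule.mem_top
  | succ j =>
    obtain rfl : n = (i + j) + 1 := by omega
    have hL := cap_leibniz ρ (show i + j = i + j from rfl) e f
    rw [LinearMap.mem_ker.1 hf.2, map_zero, zero_add] at hL
    have h1 := cap_mem_chainSub hSTU ρ (show i + j = i + j from rfl) he hf.1
    rw [hL] at h1
    have h2 := Submodule.smul_mem _ ((-1 : K) ^ i) h1
    rwa [smul_smul, ← mul_pow, neg_one_mul, neg_neg, one_pow, one_smul] at h2

theorem cap_mem_relBoundaries (hSTU : ∀ k, (∃ l, S k = T l) ∨ ∃ l, S k = U l)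
    (ρ : Representation K G M) {i j n : ℕ} (h : i + j = n)
    {e : (Fin n → G) →₀ K} (he : e ∈ relCycles (Representation.trivial K G K) S n)
    {f : (Fin i → G) → M} (hf : f ∈ relCoboundaries ρ T i) :
    cap ρ h e f ∈ relBoundaries ρ U j := by
  cases i with
  | zero =>
    obtain rfl : f = 0 := hf
    rw [map_zero]
    exact Submodule.zero_mem _
  | succ i =>
    obtain ⟨f, hf, rfl⟩ := hf
    obtain rfl : n = (i + j) + 1 := by omega
    have hL := cap_leibniz ρ (show i + j = i + j from rfl) e f
    rw [eq_comm, ← eq_sub_iff_add_eq] at hL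
    rw [hL]
    exact Submodule.sub_mem _
      (Submodule.mem_sup_right (cap_mem_chainSub hSTU ρ _ he hf))
      (Submodule.mem_sup_left (Submodule.smul_mem _ _ ⟨_, rfl⟩))

/-- The map `e ∩ • : Hⁱ(G, 𝒯; M) → H_{n-i}(G, 𝒰; M)` for a cycle `e` of `C_n(G; K) / ∑ₖ C_n(S_k; K)`
and a family `𝒮` made up of members of `𝒯` and of `𝒰`. -/
def capHom (hSTU : ∀ k, (∃ l, S k = T l) ∨ ∃ l, S k = U l)
    (ρ : Representation K G M) {i j n : ℕ} (h : i + j = n)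
    (e : relCycles (Representation.trivial K G K) S n) :
    RelCohomology ρ T i →ₗ[K] RelHomology ρ U j :=
  Submodule.mapQ _ _
    ((cap ρ h e.1).restrict fun _ hf => cap_mem_relCycles hSTU ρ h e.2 hf)
    fun _ hf => cap_mem_relBoundaries hSTU ρ h e.2 hf

end CapHom

end Cap

section Duality

variable (K : Type u) {G : Type v} [CommRing K] [Group G] {ι : Type*}

/-- `(G, 𝒮)` is a `K`-Poincaré duality pair of dimension `n`: for the class of some relative cycle
`e` with trivial coefficients, the cap products `Hⁱ(G, 𝒮; M) → H_{n-i}(G; M)` and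
`Hⁱ(G; M) → H_{n-i}(G, 𝒮; M)` are isomorphisms for all left `K[G]`-modules `M` and all integers `i`.
Groups in negative degrees are zero, whence the last two clauses. -/
def IsPoincareDualityPair (S : ι → Subgroup G) (n : ℕ) : Prop :=
  ∃ e : relCycles (Representation.trivial K G K) S n,
    ∀ (M : Type (max u v)) [AddCommGroup M] [Module K M] (ρ : Representation K G M),
      (∀ (i j : ℕ) (h : i + j = n),
        Function.Bijective (capHom (T := S) (U := noSubgroup G)
          (fun k => Or.inl ⟨k, rfl⟩) ρ h e) ∧
        Function.Bijective (capHom (T := noSubgroup G) (U := S)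
          (fun k => Or.inr ⟨k, rfl⟩) ρ h e)) ∧
      (∀ i, n < i → Subsingleton (RelCohomology ρ S i) ∧
        Subsingleton (RelCohomology ρ (noSubgroup G) i)) ∧
      (∀ j, n < j → Subsingleton (RelHomology ρ (noSubgroup G) j) ∧
        Subsingleton (RelHomology ρ S j))

end Duality

section RightDerivations

variable (K : Type u) (G : Type v) [CommRing K] [Group G]

/-- `Z¹(G; K[G])` for `K[G]` as a right module over itself: maps with `f(gh) = f(g)h + f(h)`. -/
def rightCocycles : Submodule K (G → MonoidAlgebra K G) where
  carrier := {f | ∀ g h, f (g * h) = f g * of K G h + f h}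
  add_mem' := fun ha hb g h => by simp only [Pi.add_apply, ha g h, hb g h, add_mul]; abel
  zero_mem' := fun g h => by simp
  smul_mem' := fun c f hf g h => by simp [hf g h]

/-- The map sending `c` to the inner right derivation `g ↦ c(1 - g)`. -/
def innerRight : MonoidAlgebra K G →ₗ[K] (G → MonoidAlgebra K G) :=
  LinearMap.pi fun g => LinearMap.mulRight K (1 - of K G g)

/-- `H¹(G; K[G])` for `K[G]` as a right module over itself. -/
abbrev RightH1 : Type _ :=
  rightCocycles K G ⧸ (LinearMap.range (innerRight K G)).submoduleOf (rightCocycles K G)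

variable {K G}

/-- Left multiplication by `x` on right cocycles, `(x · f)(g) = x f(g)`. -/
def leftMulCocycle (x : G) : rightCocycles K G →ₗ[K] rightCocycles K G :=
  ((LinearMap.mulLeft K (of K G x)).compLeft G).restrict fun f hf g h => by
    have := hf g h
    simp only [LinearMap.compLeft_apply, Function.comp_apply, LinearMap.mulLeft_apply, this,
      mul_add, mul_assoc]

theorem leftMulCocycle_inner (x : G) :
    (LinearMap.range (innerRight K G)).submoduleOf (rightCocycles K G) ≤
      ((LinearMap.range (innerRight K G)).submoduleOf (rightCocycles K G)).comap
        (leftMulCocycle x) := by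
  rintro ⟨f, hf⟩ ⟨c, hc⟩
  refine ⟨of K G x * c, ?_⟩
  funext g
  have : c * (1 - of K G g) = f g := congrFun hc g
  change of K G x * c * (1 - of K G g) = of K G x * f g
  rw [← this, mul_assoc]

variable (K G) in
/-- The left action of `G` on `H¹(G; K[G])` induced by left multiplication on `K[G]`. -/
def leftRep : Representation K G (RightH1 K G) where
  toFun x := Submodule.mapQ _ _ (leftMulCocycle x) (leftMulCocycle_inner x)
  map_one' := by
    ext f : 2
    change Submodule.Quotient.mk _ = Submodule.Quotient.mk _
    congr 1
    ext1; funext g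
    change of K G 1 * f.1 g = f.1 g
    rw [map_one, one_mul]
  map_mul' x y := by
    ext f : 2
    change Submodule.Quotient.mk _ = Submodule.Quotient.mk _
    congr 1
    ext1; funext g
    change of K G (x * y) * f.1 g = of K G x * (of K G y * f.1 g)
    rw [map_mul, mul_assoc]

end RightDerivations

section Fox

variable (K : Type u) (G : Type v) [CommRing K] [Group G]

/-- The augmentation `K[G] → K`. -/
def aug : MonoidAlgebra K G →ₐ[K] K := MonoidAlgebra.lift K K G 1

/-- A Fox pairing of `G` with values in the bimodule `K[G]`. -/
@[ext]
structure FoxPairing where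
  /-- the underlying bilinear map -/
  toFun : MonoidAlgebra K G →ₗ[K] MonoidAlgebra K G →ₗ[K] MonoidAlgebra K G
  map_mul_left : ∀ a₁ a₂ b, toFun (a₁ * a₂) b = aug K G a₂ • toFun a₁ b + a₁ * toFun a₂ b
  map_mul_right : ∀ a b₁ b₂, toFun a (b₁ * b₂) = toFun a b₁ * b₂ + aug K G b₁ • toFun a b₂

variable {K G}

/-- The value `η(g, h)` on group elements. -/
def FoxPairing.val (η : FoxPairing K G) (g h : G) : MonoidAlgebra K G :=
  η.toFun (of K G g) (of K G h)

theorem FoxPairing.val_mem (η : FoxPairing K G) (g : G) : η.val g ∈ rightCocycles K G := by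
  intro h k
  simp only [FoxPairing.val, map_mul, η.map_mul_right]
  simp [aug]

/-- The 1-cochain `g ↦ [η(g, •)]` of `G` with values in `H¹(G; K[G])`. -/
def FoxPairing.cochain (η : FoxPairing K G) : (Fin 1 → G) → RightH1 K G :=
  fun g => Submodule.Quotient.mk ⟨η.val (g 0), η.val_mem (g 0)⟩

/-- `η` represents a basis of `H¹(G, 𝒮; H¹(G; K[G])) ≅ K`: the cochain `g ↦ [η(g, •)]` is a relative
cocycle, and `k ↦ k • [η]` is a bijection from `K` onto the relative cohomology. -/
def FoxPairing.IsFundamental {ι : Type*} (η : FoxPairing K G) (S : ι → Subgroup G) : Prop :=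
  ∃ hη : η.cochain ∈ relCocycles (leftRep K G) S 1,
    Function.Bijective fun k : K =>
      k • (Submodule.Quotient.mk ⟨η.cochain, hη⟩ : RelCohomology (leftRep K G) S 1)

end Fox

end FoxPD

end

set_option linter.unusedSectionVars false

noncomputable section

/-! Duality makes H²(G; M) ≅ H_0(G, 𝒮; M) vanish, as the family of subgroups is nonempty. So every
relative 2-cocycle is the coboundary of a map `d : G → M` that is a derivation on each `S_k`, and it
is a relative coboundary exactly when `d` agrees on 𝒮 with a derivation of `G`. Hence H²(G, 𝒮; M) ≅
H_0(G; M) measures the obstruction to extending such maps. For M = K[G] the obstruction is a scalar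
(`obstruction`), every scalar occurs, and right multiplication by `b` scales it by `aug b`.
Extensions are unique because H¹(G, 𝒮; K[G]) ≅ H_1(G; K[G]) = 0.

Let `a` be a derivation on each `S_k`. The map s ↦ a_s(1 - y) has obstruction aug(1 - y) = 0 times
that of `a`, so it extends uniquely to a derivation of `G`. Its value at `g` is η(g, y), and
uniqueness forces the right Fox rule (`exists_foxPairing`). If the obstruction of `a` is a unit, η
represents a basis (`isFundamental`): the sequence 0 → K[G] → Z¹(G; K[G]) → B → 0 has a connecting
map H¹(G, 𝒮; B) → H²(G, 𝒮; K[G]) ≅ K, which sends the class of η, up to sign, to the obstruction of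
`a`. Exactness on the left means that K[G] has no nonzero right invariants. This holds because `G`
is infinite (`infinite`), and it also makes the a_s unique.

Part 1 takes `a` with obstruction 1. Part 2 takes the derivation on ⟨ζ⟩ with value 1 at ζ. Were its
obstruction zero, some homomorphism G → K would send ζ to 1, and every homomorphism from ⟨ζ⟩ to K[G]
would extend to `G`, contradicting duality with trivial coefficients. -/

namespace FoxPD

/-! ### Bar complexes in low degrees and change of coefficients -/

section LowDegree

variable {K : Type u} {G : Type v} {M N : Type*}
variable [CommRing K] [Group G] [AddCommGroup M] [Module K M] [AddCommGroup N] [Module K N]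

variable (K G M) in
/-- Functions on `G` as inhomogeneous 1-cochains. -/
def oneCochain : (G → M) →ₗ[K] ((Fin 1 → G) → M) :=
  LinearMap.funLeft K M fun g => g 0

@[simp]
theorem oneCochain_apply (d : G → M) (g : Fin 1 → G) : oneCochain K G M d g = d (g 0) := rfl

theorem oneCochain_surjective : Function.Surjective (oneCochain K G M) := fun F =>
  ⟨fun g => F fun _ => g, by
    funext g
    exact congrArg F (funext fun i => congrArg g (Subsingleton.elim _ _))⟩

theorem contractNth_fin_two_zero (g : Fin 2 → G) :
    Fin.contractNth (0 : Fin 2) (· * ·) g = fun _ => g 0 * g 1 := by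
  funext i; fin_cases i; rfl

theorem contractNth_fin_two_one (g : Fin 2 → G) :
    Fin.contractNth (1 : Fin 2) (· * ·) g = fun _ => g 0 := by
  funext i; fin_cases i; rfl

theorem contractNth_fin_three_zero (g : Fin 3 → G) :
    Fin.contractNth (0 : Fin 3) (· * ·) g = ![g 0 * g 1, g 2] := by
  funext i; fin_cases i <;> rfl

theorem contractNth_fin_three_one (g : Fin 3 → G) :
    Fin.contractNth (1 : Fin 3) (· * ·) g = ![g 0, g 1 * g 2] := by
  funext i; fin_cases i <;> rfl

theorem contractNth_fin_three_two (g : Fin 3 → G) :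
    Fin.contractNth (2 : Fin 3) (· * ·) g = ![g 0, g 1] := by
  funext i; fin_cases i <;> rfl

theorem cochainD_zero_apply (ρ : Representation K G M) (f : (Fin 0 → G) → M) (g : Fin 1 → G) :
    cochainD ρ 0 f g = ρ (g 0) (f default) - f default := by
  rw [cochainD_apply, Fin.sum_univ_one, Subsingleton.elim (fun i : Fin 0 => g i.succ) default,
    Subsingleton.elim (Fin.contractNth (0 : Fin 1) (· * ·) g) default]
  simp [sub_eq_add_neg]

theorem cochainD_oneCochain (ρ : Representation K G M) (d : G → M) (g : Fin 2 → G) :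
    cochainD ρ 1 (oneCochain K G M d) g = ρ (g 0) (d (g 1)) - d (g 0 * g 1) + d (g 0) := by
  rw [cochainD_apply, Fin.sum_univ_two, contractNth_fin_two_zero, contractNth_fin_two_one]
  simp [sub_eq_add_neg, add_assoc]

theorem cochainD_two_apply (ρ : Representation K G M) (f : (Fin 2 → G) → M) (g : Fin 3 → G) :
    cochainD ρ 2 f g = ρ (g 0) (f ![g 1, g 2]) - f ![g 0 * g 1, g 2] + f ![g 0, g 1 * g 2] -
      f ![g 0, g 1] := by
  rw [cochainD_apply, Fin.sum_univ_three, contractNth_fin_three_zero, contractNth_fin_three_one,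
    contractNth_fin_three_two]
  have : (fun i : Fin 2 => g i.succ) = ![g 1, g 2] := by funext i; fin_cases i <;> rfl
  rw [this]
  simp [sub_eq_add_neg, add_assoc, pow_succ]

theorem cochainD_two_comp_one (ρ : Representation K G M) (d : G → M) :
    cochainD ρ 2 (cochainD ρ 1 (oneCochain K G M d)) = 0 := by
  funext g
  rw [cochainD_two_apply]
  simp only [cochainD_oneCochain, Matrix.cons_val_zero, Matrix.cons_val_one, map_add, map_sub,
    map_mul, Module.End.mul_apply, mul_assoc, Pi.zero_apply]
  abel

theorem cochainD_oneCochain_eq_zero_iff (ρ : Representation K G M) (d : G → M) :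
    cochainD ρ 1 (oneCochain K G M d) = 0 ↔ ∀ g h, d (g * h) = d g + ρ g (d h) := by
  constructor
  · intro H g h
    have := congrFun H ![g, h]
    rw [cochainD_oneCochain] at this
    simp only [Matrix.cons_val_zero, Matrix.cons_val_one, Pi.zero_apply] at this
    rw [← sub_eq_zero, ← neg_eq_zero, ← this]
    abel
  · intro H
    funext g
    rw [cochainD_oneCochain, H]
    simp

/-- Coboundaries commute with equivariant maps of coefficients. -/
theorem cochainD_comp {ρ : Representation K G M} {σ : Representation K G N} (φ : M →ₗ[K] N)
    (hφ : ∀ g m, φ (ρ g m) = σ g (φ m)) (n : ℕ) (f : (Fin n → G) → M) :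
    cochainD σ n (fun g => φ (f g)) = fun g => φ (cochainD ρ n f g) := by
  funext g
  simp [cochainD_apply, hφ]

/-- Boundaries commute with equivariant maps of coefficients. -/
theorem chainD_mapRange {ρ : Representation K G M} {σ : Representation K G N} (φ : M →ₗ[K] N)
    (hφ : ∀ g m, φ (ρ g m) = σ g (φ m)) (n : ℕ) (c : (Fin (n + 1) → G) →₀ M) :
    chainD σ n (Finsupp.mapRange.linearMap φ c) = Finsupp.mapRange.linearMap φ (chainD ρ n c) := by
  induction c using Finsupp.induction_linear with
  | zero => simp
  | add a b ha hb => simp only [map_add, ha, hb]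
  | single g m =>
    simp only [Finsupp.mapRange.linearMap_apply, Finsupp.mapRange_single, chainD_single]
    simp only [← Finsupp.mapRange.linearMap_apply, map_add, map_sum, map_smul]
    simp [hφ]

/-- Cap products commute with equivariant maps of coefficients. -/
theorem cap_comp {ρ : Representation K G M} {σ : Representation K G N} (φ : M →ₗ[K] N)
    (hφ : ∀ g m, φ (ρ g m) = σ g (φ m)) {i j n : ℕ} (h : i + j = n) (e : (Fin n → G) →₀ K)
    (f : (Fin i → G) → M) :
    cap σ h e (fun g => φ (f g)) = Finsupp.mapRange.linearMap φ (cap ρ h e f) := by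
  induction e using Finsupp.induction_linear with
  | zero => simp
  | add a b ha hb => simp only [map_add, LinearMap.add_apply, ha, hb]
  | single g c =>
    rw [cap_single, cap_single, map_smul]
    simp [hφ]

theorem mapRange_mem_chainSub {ι : Type*} (S : ι → Subgroup G) (φ : M →ₗ[K] N) (n : ℕ)
    {c : (Fin n → G) →₀ M} (hc : c ∈ chainSub K M S n) :
    Finsupp.mapRange.linearMap φ c ∈ chainSub K N S n := by
  suffices chainSub K M S n ≤ (chainSub K N S n).comap (Finsupp.mapRange.linearMap φ) from this hc
  refine iSup_le fun k c hc => Submodule.mem_iSup_of_mem k ?_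
  rw [Finsupp.mem_supported] at hc ⊢
  exact (Finset.coe_subset.2 (Finsupp.support_mapRange (hf := map_zero φ))).trans hc

theorem mapRange_mem_relBoundaries {ι : Type*} (S : ι → Subgroup G)
    {ρ : Representation K G M} {σ : Representation K G N} (φ : M →ₗ[K] N)
    (hφ : ∀ g m, φ (ρ g m) = σ g (φ m)) (n : ℕ)
    {c : (Fin n → G) →₀ M} (hc : c ∈ relBoundaries ρ S n) :
    Finsupp.mapRange.linearMap φ c ∈ relBoundaries σ S n := by
  obtain ⟨_, ⟨b, rfl⟩, d, hd, rfl⟩ := Submodule.mem_sup.1 hc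
  rw [map_add, ← chainD_mapRange φ hφ]
  exact Submodule.add_mem _ (Submodule.mem_sup_left ⟨_, rfl⟩)
    (Submodule.mem_sup_right (mapRange_mem_chainSub S φ n hd))

theorem chainD_zero_single (ρ : Representation K G M) (g : Fin 1 → G) (m : M) :
    chainD ρ 0 (Finsupp.single g m) = Finsupp.single default (ρ (g 0)⁻¹ m - m) := by
  rw [chainD_single, Fin.sum_univ_one, Subsingleton.elim (fun i : Fin 0 => g i.succ) default,
    Subsingleton.elim (Fin.contractNth (0 : Fin 1) (· * ·) g) default]
  simp [sub_eq_add_neg, Finsupp.single_neg]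

theorem chainD_one_single (ρ : Representation K G M) (g : Fin 2 → G) (m : M) :
    chainD ρ 1 (Finsupp.single g m) = Finsupp.single (fun _ => g 1) (ρ (g 0)⁻¹ m) -
      Finsupp.single (fun _ => g 0 * g 1) m + Finsupp.single (fun _ => g 0) m := by
  rw [chainD_single, Fin.sum_univ_two, contractNth_fin_two_zero, contractNth_fin_two_one]
  have : (fun i : Fin 1 => g i.succ) = fun _ => g 1 := by funext i; fin_cases i; rfl
  rw [this]
  simp [sub_eq_add_neg, add_assoc]

theorem chainSub_noSubgroup (n : ℕ) : chainSub K M (noSubgroup G) n = ⊥ := by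
  simp [chainSub]

theorem relBoundaries_noSubgroup (ρ : Representation K G M) (n : ℕ) :
    relBoundaries ρ (noSubgroup G) n = LinearMap.range (chainD ρ n) := by
  rw [relBoundaries, chainSub_noSubgroup, sup_bot_eq]

theorem relCochains_noSubgroup (n : ℕ) : relCochains K M (noSubgroup G) n = ⊤ := by
  ext f
  simp [relCochains]

theorem relCocycles_noSubgroup (ρ : Representation K G M) (n : ℕ) :
    relCocycles ρ (noSubgroup G) n = LinearMap.ker (cochainD ρ n) := by
  rw [relCocycles, relCochains_noSubgroup, top_inf_eq]

theorem relCochains_zero {ι : Type*} [Nonempty ι] (S : ι → Subgroup G) :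
    relCochains K M S 0 = ⊥ := by
  refine le_bot_iff.1 fun f hf => ?_
  funext g
  exact hf (Classical.arbitrary ι) g fun i => i.elim0

theorem chainSub_zero {ι : Type*} [Nonempty ι] (S : ι → Subgroup G) :
    chainSub K M S 0 = ⊤ := by
  refine top_le_iff.1 fun c _ => Submodule.mem_iSup_of_mem (Classical.arbitrary ι) ?_
  rw [Finsupp.mem_supported]
  exact fun g _ i => i.elim0

theorem oneCochain_mem_relCochains {ι : Type*} {S : ι → Subgroup G} {d : G → M} :
    oneCochain K G M d ∈ relCochains K M S 1 ↔ ∀ k, ∀ s ∈ S k, d s = 0 :=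
  ⟨fun H k s hs => H k (fun _ => s) fun _ => hs, fun H k g hg => H k (g 0) (hg 0)⟩

end LowDegree

section CapHomBijective

variable {K : Type u} {G : Type v} {M : Type w} {ι κ τ : Type*}
variable [CommRing K] [Group G] [AddCommGroup M] [Module K M]
variable {S : ι → Subgroup G} {T : κ → Subgroup G} {U : τ → Subgroup G}
variable {hSTU : ∀ k, (∃ l, S k = T l) ∨ ∃ l, S k = U l}
variable {ρ : Representation K G M} {i j n : ℕ} {h : i + j = n}
variable {e : relCycles (Representation.trivial K G K) S n}

theorem mem_relCoboundaries_of_capHom_injective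
    (H : Function.Injective (capHom hSTU ρ h e)) {f : (Fin i → G) → M} (hf : f ∈ relCocycles ρ T i)
    (hc : cap ρ h e.1 f ∈ relBoundaries ρ U j) : f ∈ relCoboundaries ρ T i := by
  have : (Submodule.Quotient.mk ⟨f, hf⟩ : RelCohomology ρ T i) = 0 := by
    apply H
    rw [map_zero]
    exact (Submodule.Quotient.mk_eq_zero ((relBoundaries ρ U j).submoduleOf _)).2 hc
  exact (Submodule.Quotient.mk_eq_zero ((relCoboundaries ρ T i).submoduleOf _)).1 this

theorem exists_cap_sub_mem_of_capHom_surjective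
    (H : Function.Surjective (capHom hSTU ρ h e)) {z : (Fin j → G) →₀ M}
    (hz : z ∈ relCycles ρ U j) :
    ∃ f ∈ relCocycles ρ T i, cap ρ h e.1 f - z ∈ relBoundaries ρ U j := by
  obtain ⟨x, hx⟩ := H (Submodule.Quotient.mk ⟨z, hz⟩)
  obtain ⟨⟨f, hf⟩, rfl⟩ := Submodule.Quotient.mk_surjective _ x
  exact ⟨f, hf, (Submodule.Quotient.eq ((relBoundaries ρ U j).submoduleOf _)).1 hx⟩

end CapHomBijective

/-! ### Derivations as 1-cocycles -/

section Derivations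

variable {K : Type u} {G : Type v} {M : Type*}
variable [CommRing K] [Group G] [AddCommGroup M] [Module K M]

/-- Derivations `G → M`, that is, `d(gh) = d(g) + g d(h)`. -/
def IsDerivation (ρ : Representation K G M) (d : G → M) : Prop :=
  ∀ g h, d (g * h) = d g + ρ g (d h)

/-- Functions `G → M` whose restrictions to the subgroups `S_k` are derivations. -/
def IsDerivationOn {ι : Type*} (S : ι → Subgroup G) (ρ : Representation K G M) (d : G → M) :
    Prop :=
  ∀ k, ∀ s ∈ S k, ∀ t ∈ S k, d (s * t) = d s + ρ s (d t)

theorem cochainD_mem_relCocycles {ι : Type*} {S : ι → Subgroup G} {ρ : Representation K G M}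
    {d : G → M} (hd : IsDerivationOn S ρ d) :
    cochainD ρ 1 (oneCochain K G M d) ∈ relCocycles ρ S 2 := by
  refine ⟨fun k g hg => ?_, cochainD_two_comp_one ρ d⟩
  rw [cochainD_oneCochain, hd k _ (hg 0) _ (hg 1)]
  simp

theorem isDerivationOn_of_cochainD_mem {ι : Type*} {S : ι → Subgroup G} {ρ : Representation K G M}
    {d : G → M} (hd : cochainD ρ 1 (oneCochain K G M d) ∈ relCochains K M S 2) :
    IsDerivationOn S ρ d := by
  intro k s hs t ht
  have := hd k ![s, t] (by intro i; fin_cases i <;> assumption)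
  rw [cochainD_oneCochain] at this
  simp only [Matrix.cons_val_zero, Matrix.cons_val_one] at this
  rw [← sub_eq_zero, ← neg_eq_zero, ← this]
  abel

theorem relCoboundaries_one {ι : Type*} [Nonempty ι] (S : ι → Subgroup G)
    (ρ : Representation K G M) : relCoboundaries ρ S 1 = ⊥ := by
  rw [relCoboundaries, relCochains_zero, Submodule.map_bot]

theorem IsDerivation.map_one {ρ : Representation K G M} {d : G → M} (hd : IsDerivation ρ d) :
    d 1 = 0 := by
  have := hd 1 1
  simpa using this

end Derivations

/-! ### Homology of the regular module in degrees 0 and 1 -/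

section RegularModule

variable {K : Type u} {G : Type v} {M : Type*}
variable [CommRing K] [Group G] [AddCommGroup M] [Module K M]

variable (K G) in
/-- The group algebra as a left module over itself. -/
def leftReg : Representation K G (MonoidAlgebra K G) :=
  (Algebra.lmul K (MonoidAlgebra K G)).toMonoidHom.comp (of K G)

@[simp]
theorem leftReg_apply (g : G) (a : MonoidAlgebra K G) : leftReg K G g a = of K G g * a := rfl

variable (K) in
/-- The linear extension to `K[G]` of a function on `G`. -/
def linearExtension (f : G → M) : MonoidAlgebra K G →ₗ[K] M :=
  Finsupp.linearCombination K f ∘ₗ (coeffLinearEquiv K).toLinearMap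

theorem linearExtension_single (f : G → M) (g : G) (r : K) :
    linearExtension K f (single g r) = r • f g := by
  simp [linearExtension]

@[simp]
theorem linearExtension_of (f : G → M) (g : G) : linearExtension K f (of K G g) = f g := by
  simp [linearExtension_single, of_apply]

@[simp]
theorem aug_of (g : G) : aug K G (of K G g) = 1 := by
  simp [aug]

theorem linearMap_ext_of {f f' : MonoidAlgebra K G →ₗ[K] M}
    (h : ∀ g, f (of K G g) = f' (of K G g)) : f = f' := by
  refine LinearMap.ext fun x => ?_
  induction x using MonoidAlgebra.induction_on with
  | of g => exact h g
  | add x y hx hy => rw [map_add, map_add, hx, hy]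
  | smul r x hx => rw [map_smul, map_smul, hx]

/-- Contraction of the bar complex of `K[G]`, from degree 0 to degree 1. -/
def contractZero : ((Fin 0 → G) →₀ MonoidAlgebra K G) →ₗ[K] ((Fin 1 → G) →₀ MonoidAlgebra K G) :=
  linearExtension K (fun x => Finsupp.single (fun _ => x⁻¹) (of K G 1)) ∘ₗ Finsupp.lapply default

/-- Contraction of the bar complex of `K[G]`, from degree 1 to degree 2. -/
def contractOne : ((Fin 1 → G) →₀ MonoidAlgebra K G) →ₗ[K] ((Fin 2 → G) →₀ MonoidAlgebra K G) :=
  Finsupp.lsum K fun g => linearExtension K fun x => Finsupp.single ![x⁻¹, g 0] (of K G 1)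

/-- The contraction prepends x⁻¹ to the bar and replaces the coefficient x by 1, so that the first
face restores x. The remaining faces cancel. It follows that H_1(G; K[G]) = 0. -/
theorem chainD_contractOne (z : (Fin 1 → G) →₀ MonoidAlgebra K G) :
    chainD (leftReg K G) 1 (contractOne z) + contractZero (chainD (leftReg K G) 0 z) = z := by
  suffices chainD (leftReg K G) 1 ∘ₗ contractOne + contractZero ∘ₗ chainD (leftReg K G) 0 =
    LinearMap.id from LinearMap.congr_fun this z
  refine Finsupp.lhom_ext' fun g => linearMap_ext_of fun x => ?_
  have hg : (fun _ : Fin 1 => g 0) = g := by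
    funext i; rw [Subsingleton.elim i 0]
  simp only [LinearMap.comp_apply, LinearMap.add_apply, Finsupp.lsingle_apply, contractOne,
    contractZero, Finsupp.lsum_single, linearExtension_of, chainD_one_single,
    chainD_zero_single, Finsupp.lapply_apply, Finsupp.single_eq_same, map_sub, leftReg_apply,
    Matrix.cons_val_zero, Matrix.cons_val_one, ← map_mul, mul_one, inv_inv, mul_inv_rev,
    LinearMap.id_apply, hg]
  abel

theorem mem_range_chainD_one {z : (Fin 1 → G) →₀ MonoidAlgebra K G}
    (hz : chainD (leftReg K G) 0 z = 0) : z ∈ LinearMap.range (chainD (leftReg K G) 1) :=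
  ⟨contractOne z, by simpa [hz] using chainD_contractOne z⟩

/-- This identifies H_0(G; K[G]) with K: modulo boundaries each group element equals 1, hence each
`a` equals `aug a`. -/
theorem mem_range_chainD_zero_iff (z : (Fin 0 → G) →₀ MonoidAlgebra K G) :
    z ∈ LinearMap.range (chainD (leftReg K G) 0) ↔ aug K G (z default) = 0 := by
  constructor
  · rintro ⟨c, rfl⟩
    suffices (aug K G).toLinearMap ∘ₗ Finsupp.lapply default ∘ₗ chainD (leftReg K G) 0 = 0 from
      LinearMap.congr_fun this c
    refine Finsupp.lhom_ext' fun g => LinearMap.ext fun x => ?_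
    simp [chainD_zero_single, -of_apply]
  · intro hz
    have key : ∀ a : MonoidAlgebra K G,
        Finsupp.single default (a - aug K G a • of K G 1) ∈
          LinearMap.range (chainD (leftReg K G) 0) := by
      intro a
      induction a using MonoidAlgebra.induction_on with
      | of g =>
        refine ⟨Finsupp.single (fun _ => g⁻¹) (of K G 1), ?_⟩
        rw [chainD_zero_single, leftReg_apply, inv_inv, ← map_mul, mul_one, aug_of, one_smul]
      | add x y hx hy =>
        rw [map_add, add_smul, add_sub_add_comm, Finsupp.single_add]
        exact Submodule.add_mem _ hx hy
      | smul r x hx =>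
        rw [map_smul, smul_eq_mul, mul_smul, ← smul_sub, ← Finsupp.smul_single]
        exact Submodule.smul_mem _ _ hx
    have := key (z default)
    rwa [hz, zero_smul, sub_zero, ← Finsupp.unique_single z] at this

end RegularModule

/-! ### Duality and the obstruction to extending derivations -/

section Duality

variable {K : Type u} {G : Type v} [CommRing K] [Group G] {ι : Type*} {S : ι → Subgroup G}

/-- The cap products with `e` are isomorphisms for all coefficients. -/
def IsFundamentalClass {n : ℕ} (e : relCycles (Representation.trivial K G K) S n) : Prop :=
  ∀ (M : Type (max u v)) [AddCommGroup M] [Module K M] (ρ : Representation K G M)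
    (i j : ℕ) (h : i + j = n),
    Function.Bijective (capHom (T := S) (U := noSubgroup G) (fun k => Or.inl ⟨k, rfl⟩) ρ h e) ∧
    Function.Bijective (capHom (T := noSubgroup G) (U := S) (fun k => Or.inr ⟨k, rfl⟩) ρ h e)

variable [Nonempty ι] {e : relCycles (Representation.trivial K G K) S 2}
variable {M : Type (max u v)} [AddCommGroup M] [Module K M]

/-- `H²(G; M) = 0`. -/
theorem IsFundamentalClass.exists_cochainD_eq (he : IsFundamentalClass e)
    (ρ : Representation K G M) {f : (Fin 2 → G) → M} (hf : cochainD ρ 2 f = 0) :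
    ∃ d : G → M, cochainD ρ 1 (oneCochain K G M d) = f := by
  have hf' : f ∈ relCocycles ρ (noSubgroup G) 2 := by
    rw [relCocycles_noSubgroup]; exact hf
  -- The dual group H_0(G, 𝒮; M) is zero: every 0-chain lies in `chainSub`.
  obtain ⟨F, -, hF⟩ := mem_relCoboundaries_of_capHom_injective (he M ρ 2 0 rfl).2.1 hf' (by
    rw [relBoundaries, chainSub_zero, sup_top_eq]; exact Submodule.mem_top)
  obtain ⟨d, rfl⟩ := oneCochain_surjective (K := K) F
  exact ⟨d, hF⟩

/-- Every class in H_0(G; M) is an obstruction: it is dual to a relative 2-cocycle, which is an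
absolute coboundary since H²(G; M) = 0. -/
theorem IsFundamentalClass.exists_isDerivationOn (he : IsFundamentalClass e)
    (ρ : Representation K G M) (z : (Fin 0 → G) →₀ M) :
    ∃ d : G → M, IsDerivationOn S ρ d ∧
      cap ρ rfl e.1 (cochainD ρ 1 (oneCochain K G M d)) - z ∈ LinearMap.range (chainD ρ 0) := by
  obtain ⟨f, hf, hfz⟩ := exists_cap_sub_mem_of_capHom_surjective (he M ρ 2 0 rfl).1.2
    (z := z) Submodule.mem_top
  obtain ⟨d, rfl⟩ := he.exists_cochainD_eq ρ hf.2
  rw [relBoundaries_noSubgroup] at hfz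
  exact ⟨d, isDerivationOn_of_cochainD_mem hf.1, hfz⟩

/-- A map that is a derivation on each `S_k` agrees on `⋃ S_k` with a derivation of `G` if and only
if its obstruction in `H_0(G; M)` vanishes. -/
theorem IsFundamentalClass.cap_mem_range_iff (he : IsFundamentalClass e)
    (ρ : Representation K G M) {d : G → M} (hd : IsDerivationOn S ρ d) :
    cap ρ rfl e.1 (cochainD ρ 1 (oneCochain K G M d)) ∈ LinearMap.range (chainD ρ 0) ↔
      ∃ c, IsDerivation ρ c ∧ ∀ k, ∀ s ∈ S k, c s = d s := by
  rw [← relBoundaries_noSubgroup]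
  constructor
  · intro H
    obtain ⟨F, hF, hFd⟩ := mem_relCoboundaries_of_capHom_injective (he M ρ 2 0 rfl).1.1
      (cochainD_mem_relCocycles hd) H
    obtain ⟨b, rfl⟩ := oneCochain_surjective (K := K) F
    refine ⟨d - b, ?_, fun k s hs => ?_⟩
    · refine (cochainD_oneCochain_eq_zero_iff ρ _).1 ?_
      rw [map_sub, map_sub, hFd, sub_self]
    · rw [Pi.sub_apply, oneCochain_mem_relCochains.1 hF k s hs, sub_zero]
  · rintro ⟨c, hc, hcd⟩
    refine cap_mem_relBoundaries (T := S) (i := 2) (fun k => Or.inl ⟨k, rfl⟩) ρ rfl e.2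
      ⟨oneCochain K G M (d - c), oneCochain_mem_relCochains.2 fun k s hs => ?_, ?_⟩
    · rw [Pi.sub_apply, hcd k s hs, sub_self]
    · rw [map_sub, map_sub, (cochainD_oneCochain_eq_zero_iff ρ _).2 hc, sub_zero]

/-- `H¹(G, 𝒮; K[G]) = 0`. -/
theorem IsFundamentalClass.derivation_eq_zero (he : IsFundamentalClass e)
    {d : G → MonoidAlgebra K G} (hd : IsDerivation (leftReg K G) d)
    (hS : ∀ k, ∀ s ∈ S k, d s = 0) : d = 0 := by
  have hd' : oneCochain K G _ d ∈ relCocycles (leftReg K G) S 1 :=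
    ⟨oneCochain_mem_relCochains.2 hS, (cochainD_oneCochain_eq_zero_iff _ _).2 hd⟩
  have h1 := cap_mem_relCycles (U := noSubgroup G) (fun k => Or.inl ⟨k, rfl⟩) (leftReg K G)
    (show 1 + 1 = 2 from rfl) e.2 hd'
  -- The dual group is H_1(G; K[G]) = 0. There are no nonzero relative 1-coboundaries, so `d` itself
  -- vanishes.
  have h2 := mem_relCoboundaries_of_capHom_injective (he _ (leftReg K G) 1 1 rfl).1.1 hd' (by
    rw [relBoundaries_noSubgroup]
    rw [relCycles, chainSub_noSubgroup] at h1
    exact mem_range_chainD_one h1)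
  rw [relCoboundaries_one, Submodule.mem_bot] at h2
  funext g
  exact congrFun h2 fun _ => g

variable (e) in
/-- The obstruction in `H_0(G; K[G]) = K` to extending a map that is a derivation on each `S_k`. -/
def obstruction : (G → MonoidAlgebra K G) →ₗ[K] K :=
  (aug K G).toLinearMap ∘ₗ Finsupp.lapply default ∘ₗ
    cap (leftReg K G) (show 2 + 0 = 2 from rfl) e.1 ∘ₗ cochainD (leftReg K G) 1 ∘ₗ oneCochain K G _

theorem IsFundamentalClass.obstruction_eq_zero_iff (he : IsFundamentalClass e)
    {d : G → MonoidAlgebra K G} (hd : IsDerivationOn S (leftReg K G) d) :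
    obstruction e d = 0 ↔
      ∃ c, IsDerivation (leftReg K G) c ∧ ∀ k, ∀ s ∈ S k, c s = d s := by
  rw [← he.cap_mem_range_iff _ hd, mem_range_chainD_zero_iff]
  rfl

theorem IsFundamentalClass.exists_obstruction_eq_one (he : IsFundamentalClass e) :
    ∃ d : G → MonoidAlgebra K G, IsDerivationOn S (leftReg K G) d ∧ obstruction e d = 1 := by
  obtain ⟨d, hd, h⟩ := he.exists_isDerivationOn (leftReg K G) (Finsupp.single default (of K G 1))
  refine ⟨d, hd, ?_⟩
  rw [mem_range_chainD_zero_iff, Finsupp.sub_apply, map_sub, Finsupp.single_eq_same, aug_of,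
    sub_eq_zero] at h
  exact h

/-- Right multiplication by `b` is equivariant for the left action, so it passes through coboundary
and cap product; on H_0(G; K[G]) = K it acts as `aug b`. -/
theorem obstruction_mul (d : G → MonoidAlgebra K G) (b : MonoidAlgebra K G) :
    obstruction e (fun g => d g * b) = obstruction e d * aug K G b := by
  have hφ : ∀ (g : G) (m : MonoidAlgebra K G), LinearMap.mulRight K b (leftReg K G g m) =
      leftReg K G g (LinearMap.mulRight K b m) := fun g m => mul_assoc _ _ _
  have h1 := cochainD_comp (LinearMap.mulRight K b) hφ 1 (oneCochain K G _ d)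
  have h2 := cap_comp (LinearMap.mulRight K b) hφ (show 2 + 0 = 2 from rfl) e.1
    (cochainD (leftReg K G) 1 (oneCochain K G _ d))
  rw [← h1] at h2
  change aug K G (cap (leftReg K G) (show 2 + 0 = 2 from rfl) e.1 (cochainD (leftReg K G) 1
    fun g => LinearMap.mulRight K b (oneCochain K G _ d g)) default) = _
  rw [h2]
  simp [obstruction]

end Duality

/-! ### Coinduced modules and invariants of the group algebra -/

section Coinduced

variable {K : Type u} {G : Type v} {V : Type*}
variable [CommRing K] [Group G] [AddCommGroup V] [Module K V]

variable (K G V) in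
/-- The coinduced module of all functions `G → V`. -/
def coinduced : Representation K G (G → V) where
  toFun g := LinearMap.funLeft K V fun k => g⁻¹ * k
  map_one' := by ext; simp [LinearMap.funLeft]
  map_mul' g h := by ext; simp [LinearMap.funLeft, mul_assoc]

theorem coinduced_apply (g : G) (φ : G → V) (k : G) : coinduced K G V g φ k = φ (g⁻¹ * k) := rfl

theorem IsDerivation.exists_eq_of_coinduced {d : G → G → V}
    (hd : IsDerivation (coinduced K G V) d) : ∃ m, ∀ g, d g = coinduced K G V g m - m := by
  -- The derivation rule for k = g · g⁻¹k, evaluated at k, reads d(k)(k) = d(g)(k) + d(g⁻¹k)(g⁻¹k).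
  refine ⟨fun k => -d k k, fun g => ?_⟩
  funext k
  have := congrFun (hd g (g⁻¹ * k)) k
  rw [mul_inv_cancel_left, Pi.add_apply, coinduced_apply] at this
  rw [Pi.sub_apply, coinduced_apply, this]
  abel

variable (V) in
/-- For finite `G`, every module is an equivariant quotient of the coinduced one. -/
def coinducedSum [Fintype G] (ρ : Representation K G V) : (G → V) →ₗ[K] V :=
  ∑ k, ρ k ∘ₗ LinearMap.proj k

theorem coinducedSum_apply [Fintype G] (ρ : Representation K G V) (φ : G → V) :
    coinducedSum V ρ φ = ∑ k, ρ k (φ k) := by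
  simp [coinducedSum, LinearMap.sum_apply]

theorem coinducedSum_equivariant [Fintype G] (ρ : Representation K G V) (g : G) (φ : G → V) :
    coinducedSum V ρ (coinduced K G V g φ) = ρ g (coinducedSum V ρ φ) := by
  simp only [coinducedSum_apply, map_sum, coinduced_apply]
  refine (Fintype.sum_equiv (Equiv.mulLeft g) _ _ fun k => ?_).symm
  simp

theorem coinducedSum_single [Fintype G] [DecidableEq G] (ρ : Representation K G V) (v : V) :
    coinducedSum V ρ (Pi.single 1 v) = v := by
  rw [coinducedSum_apply, Finset.sum_eq_single 1 (fun k _ hk => by simp [Pi.single_eq_of_ne hk])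
    (by simp)]
  simp

variable (K G) in
/-- The augmentation ideal as a left module. -/
def augIdealRep : Representation K G (LinearMap.ker (aug K G).toLinearMap) where
  toFun g := (leftReg K G g).restrict fun x hx => by
    rw [LinearMap.mem_ker, AlgHom.toLinearMap_apply] at *
    rw [leftReg_apply, map_mul, hx, mul_zero]
  map_one' := by ext; simp
  map_mul' g h := by ext; simp

end Coinduced

section Coefficients

variable {K : Type u} {G : Type v} [CommRing K] [Group G]

theorem coeff_of_mul_eq (z : MonoidAlgebra K G) (hz : ∀ g, of K G g * z = z) (g : G) :
    z.coeff g = z.coeff 1 := by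
  have := congrArg (fun x => x.coeff g) (hz g)
  simpa [of_apply] using this.symm

theorem coeff_mul_of_eq (z : MonoidAlgebra K G) (hz : ∀ g, z * of K G g = z) (g : G) :
    z.coeff g = z.coeff 1 := by
  have := congrArg (fun x => x.coeff g) (hz g)
  simpa [of_apply] using this.symm

theorem aug_eq_card_mul [Fintype G] (z : MonoidAlgebra K G) (hz : ∀ g, of K G g * z = z) :
    aug K G z = Fintype.card G * z.coeff 1 := by
  rw [aug, lift_apply, Finsupp.sum_fintype _ _ (by simp)]
  simp [coeff_of_mul_eq z hz]

end Coefficients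

/-! ### Infinitude of `G` -/

section Duality

variable {K : Type u} {G : Type v} [CommRing K] [Group G] {ι : Type*} {S : ι → Subgroup G}
variable [Nonempty ι] {e : relCycles (Representation.trivial K G K) S 2}

/-- `H¹(G; V) = 0` for all `V` if `G` is finite. -/
theorem IsFundamentalClass.exists_eq_of_isDerivation [Finite G] (he : IsFundamentalClass e)
    {V : Type (max u v)} [AddCommGroup V] [Module K V] (ρ : Representation K G V) {d : G → V}
    (hd : IsDerivation ρ d) : ∃ v, ∀ g, d g = ρ g v - v := by
  classical
  have := Fintype.ofFinite G
  set z := cap ρ (show 1 + 1 = 2 from rfl) e.1 (oneCochain K G V d) with hz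
  have hd' : oneCochain K G V d ∈ relCocycles ρ (noSubgroup G) 1 := by
    rw [relCocycles_noSubgroup]
    exact (cochainD_oneCochain_eq_zero_iff _ _).2 hd
  -- Every 1-chain is a relative cycle, so H_1(G, 𝒮; •) preserves surjections. The dual chain of `d`
  -- is lifted to the coinduced module, whose H¹, and hence whose H_1(G, 𝒮), is zero, and is then
  -- pushed back to `V`.
  obtain ⟨F, hF, hFz⟩ := exists_cap_sub_mem_of_capHom_surjective
    (he (G → V) (coinduced K G V) 1 1 rfl).2.2
    (z := Finsupp.mapRange.linearMap (LinearMap.single K (fun _ : G => V) 1) z) (by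
      rw [relCycles, chainSub_zero]; exact Submodule.mem_top)
  obtain ⟨D, rfl⟩ := oneCochain_surjective (K := K) F
  rw [relCocycles_noSubgroup] at hF
  obtain ⟨m, hm⟩ :=
    IsDerivation.exists_eq_of_coinduced ((cochainD_oneCochain_eq_zero_iff _ D).1 hF)
  have hb := cap_mem_relBoundaries (T := noSubgroup G) (U := S) (i := 1)
    (fun k => Or.inr ⟨k, rfl⟩) (coinduced K G V) (show 1 + 1 = 2 from rfl) e.2
    (f := oneCochain K G _ D) ⟨fun _ => m, by rw [relCochains_noSubgroup]; exact Submodule.mem_top,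
      by funext g; rw [cochainD_zero_apply, oneCochain_apply, hm]⟩
  have hzB := mapRange_mem_relBoundaries S (coinducedSum V ρ) (coinducedSum_equivariant ρ) 1
    (Submodule.sub_mem _ hb hFz)
  rw [sub_sub_cancel, ← LinearMap.comp_apply, ← Finsupp.mapRange.linearMap_comp,
    show coinducedSum V ρ ∘ₗ LinearMap.single K (fun _ : G => V) 1 = LinearMap.id from
      LinearMap.ext (coinducedSum_single ρ), Finsupp.mapRange.linearMap_id,
    LinearMap.id_apply] at hzB
  obtain ⟨v, -, hv⟩ := mem_relCoboundaries_of_capHom_injective (he V ρ 1 1 rfl).2.1 hd' hzB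
  refine ⟨v default, fun g => ?_⟩
  have := congrFun hv fun _ => g
  rwa [cochainD_zero_apply, oneCochain_apply, eq_comm] at this

/-- The derivation g ↦ g - 1 into the augmentation ideal is inner, given by some `v`. Then 1 - v is
left invariant of augmentation 1, and its coefficients are all equal. -/
theorem IsFundamentalClass.card_mul_eq_one [Fintype G] (he : IsFundamentalClass e) :
    ∃ r : K, (Fintype.card G : K) * r = 1 := by
  let d : G → LinearMap.ker (aug K G).toLinearMap := fun g => ⟨of K G g - of K G 1, by
    rw [LinearMap.mem_ker, AlgHom.toLinearMap_apply, map_sub, aug_of, aug_of, sub_self]⟩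
  have hd : IsDerivation (augIdealRep K G) d := fun g h => by
    ext1
    change of K G (g * h) - of K G 1 =
      (of K G g - of K G 1) + of K G g * (of K G h - of K G 1)
    rw [mul_sub, ← map_mul, ← map_mul, mul_one]
    abel
  obtain ⟨v, hv⟩ := he.exists_eq_of_isDerivation _ hd
  have hz : ∀ g, of K G g * (1 - v.1) = 1 - v.1 := by
    intro g
    have : of K G g - of K G 1 = of K G g * v.1 - v.1 := congrArg Subtype.val (hv g)
    rw [mul_sub, mul_one, sub_eq_sub_iff_sub_eq_sub, ← this, map_one]
  refine ⟨(1 - v.1).coeff 1, ?_⟩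
  rw [← aug_eq_card_mul _ hz, map_sub, map_one, show aug K G v.1 = 0 from v.2, sub_zero]

/-- Not every map that is a homomorphism on each `S_k` agrees on `⋃ S_k` with a homomorphism. -/
theorem IsFundamentalClass.exists_not_extends [Nontrivial K] (he : IsFundamentalClass e) :
    ∃ d : G → MonoidAlgebra K G, (∀ k, ∀ s ∈ S k, ∀ t ∈ S k, d (s * t) = d s + d t) ∧
      ∀ χ : G → MonoidAlgebra K G, (∀ g h, χ (g * h) = χ g + χ h) →
        ¬ ∀ k, ∀ s ∈ S k, χ s = d s := by
  -- With trivial action H_0(G; M) is all of M. The module K[G] serves in place of K because it lies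
  -- in the universe of the coefficients.
  obtain ⟨d, hd, h⟩ := he.exists_isDerivationOn
    (Representation.trivial K G (MonoidAlgebra K G)) (Finsupp.single default 1)
  refine ⟨d, hd, fun χ hχ H => ?_⟩
  have h0 : chainD (Representation.trivial K G (MonoidAlgebra K G)) 0 = 0 :=
    Finsupp.lhom_ext' fun g => LinearMap.ext fun x => by simp [chainD_zero_single]
  have := (he.cap_mem_range_iff _ hd).2 ⟨χ, hχ, H⟩
  rw [h0, LinearMap.range_zero, Submodule.mem_bot] at this h
  rw [this, zero_sub, neg_eq_zero, Finsupp.single_eq_zero] at h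
  exact one_ne_zero h

/-- If `G` were finite, its order would be invertible in K yet kill every homomorphism from `S_k` to
K[G]. All of these would be zero and would extend to `G`, against `exists_not_extends`. -/
theorem IsFundamentalClass.infinite [Nontrivial K] (he : IsFundamentalClass e) : Infinite G := by
  by_contra hG
  rw [not_infinite_iff_finite] at hG
  have := Fintype.ofFinite G
  obtain ⟨r, hr⟩ := he.card_mul_eq_one
  obtain ⟨d, hd, hχ⟩ := he.exists_not_extends
  refine hχ 0 (fun _ _ => by simp) fun k s hs => ?_
  have h1 : d 1 = 0 := by simpa using hd k 1 (one_mem _) 1 (one_mem _)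
  have hpow : ∀ n : ℕ, d (s ^ n) = (n : K) • d s := by
    intro n
    induction n with
    | zero => simp [h1]
    | succ n ih =>
      rw [pow_succ, hd k _ (pow_mem hs n) _ hs, ih, Nat.cast_succ, add_smul, one_smul]
  have := hpow (Fintype.card G)
  rw [pow_card_eq_one, h1] at this
  rw [Pi.zero_apply, ← one_smul K (d s), ← hr, mul_comm, mul_smul, ← this, smul_zero]

/-- `H⁰(G; K[G]) = 0` for `K[G]` as a right module. -/
theorem IsFundamentalClass.eq_zero_of_mul (he : IsFundamentalClass e) {c : MonoidAlgebra K G}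
    (hc : ∀ g, c * (1 - of K G g) = 0) : c = 0 := by
  nontriviality K
  have := he.infinite
  have hc' : ∀ g, c * of K G g = c := fun g => by
    have := hc g
    rwa [mul_sub, mul_one, sub_eq_zero, eq_comm] at this
  -- A right invariant element has constant coefficients, and finite support makes the constant 0.
  obtain ⟨g, hg⟩ := Infinite.exists_notMem_finset c.coeff.support
  rw [Finsupp.notMem_support_iff, coeff_mul_of_eq c hc'] at hg
  ext h
  rw [coeff_mul_of_eq c hc', hg]
  rfl

end Duality

/-! ### Fox pairings through their values on group elements -/

section FoxValues

variable {K : Type u} {G : Type v} [CommRing K] [Group G]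

theorem FoxPairing.val_isDerivation (η : FoxPairing K G) (h : G) :
    IsDerivation (leftReg K G) fun g => η.val g h := by
  intro g g'
  simp only [FoxPairing.val, map_mul, η.map_mul_left, aug_of, one_smul, leftReg_apply]

theorem FoxPairing.ext_val {η η' : FoxPairing K G} (h : ∀ g x, η.val g x = η'.val g x) : η = η' :=
  FoxPairing.ext (linearMap_ext_of fun g => linearMap_ext_of fun x => h g x)

/-- The Fox pairing with given values on group elements. -/
def FoxPairing.ofVal (F : G → G → MonoidAlgebra K G)
    (hl : ∀ h, IsDerivation (leftReg K G) fun g => F g h) (hr : ∀ g, F g ∈ rightCocycles K G) :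
    FoxPairing K G where
  toFun := linearExtension K fun g => linearExtension K (F g)
  map_mul_left a₁ a₂ b := by
    induction a₁ using MonoidAlgebra.induction_on with
    | add x y hx hy => simp only [add_mul, map_add, LinearMap.add_apply, smul_add, hx, hy]; abel
    | smul r x hx =>
      simp only [smul_mul_assoc, map_smul, LinearMap.smul_apply, hx, smul_add, smul_comm r]
    | of g =>
      induction a₂ using MonoidAlgebra.induction_on with
      | add x y hx hy =>
        simp only [mul_add, map_add, LinearMap.add_apply, add_smul, hx, hy]; abel
      | smul r x hx =>
        simp only [mul_smul_comm, map_smul, LinearMap.smul_apply, hx, smul_add, smul_assoc]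
      | of g' =>
        induction b using MonoidAlgebra.induction_on with
        | add x y hx hy => simp only [map_add, smul_add, mul_add, hx, hy]; abel
        | smul r x hx =>
          simp only [map_smul, hx, smul_add, smul_comm r, mul_smul_comm]
        | of h =>
          rw [← map_mul]
          simp only [linearExtension_of, aug_of, one_smul]
          exact hl h g g'
  map_mul_right a b₁ b₂ := by
    induction a using MonoidAlgebra.induction_on with
    | add x y hx hy => simp only [add_mul, map_add, LinearMap.add_apply, smul_add, hx, hy]; abel
    | smul r x hx =>
      simp only [smul_mul_assoc, map_smul, LinearMap.smul_apply, hx, smul_add, smul_comm r]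
    | of g =>
      induction b₁ using MonoidAlgebra.induction_on with
      | add x y hx hy => simp only [add_mul, map_add, add_smul, hx, hy]; abel
      | smul r x hx => simp only [smul_mul_assoc, map_smul, hx, smul_add, smul_assoc]
      | of h =>
        induction b₂ using MonoidAlgebra.induction_on with
        | add x y hx hy => simp only [mul_add, map_add, smul_add, hx, hy]; abel
        | smul r x hx => simp only [mul_smul_comm, map_smul, hx, smul_add, smul_comm r]
        | of h' =>
          rw [← map_mul]
          simp only [linearExtension_of, aug_of, one_smul]
          exact hr g h h'

@[simp]
theorem FoxPairing.ofVal_val (F : G → G → MonoidAlgebra K G)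
    (hl : ∀ h, IsDerivation (leftReg K G) fun g => F g h) (hr : ∀ g, F g ∈ rightCocycles K G)
    (g h : G) : (FoxPairing.ofVal F hl hr).val g h = F g h := by
  simp [FoxPairing.val, FoxPairing.ofVal, -of_apply]

theorem mk_rightH1_eq_zero_iff (f : rightCocycles K G) :
    (Submodule.Quotient.mk f : RightH1 K G) = 0 ↔
      ∃ c : MonoidAlgebra K G, ∀ g, c * (1 - of K G g) = f.1 g :=
  (Submodule.Quotient.mk_eq_zero _).trans <|
    exists_congr fun _ => ⟨fun h g => congrFun h g, fun h => funext h⟩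

theorem mk_rightH1_eq_iff (f f' : rightCocycles K G) :
    (Submodule.Quotient.mk f : RightH1 K G) = Submodule.Quotient.mk f' ↔
      ∃ c : MonoidAlgebra K G, ∀ g, c * (1 - of K G g) = f.1 g - f'.1 g :=
  (Submodule.Quotient.eq _).trans <|
    exists_congr fun _ => ⟨fun h g => congrFun h g, fun h => funext h⟩

variable (K G) in
/-- Functions `G → K[G]` with the pointwise left action. -/
def leftRegFun : Representation K G (G → MonoidAlgebra K G) where
  toFun g := (leftReg K G g).compLeft G
  map_one' := by ext; simp
  map_mul' g h := by ext; simp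

theorem innerRight_apply (c : MonoidAlgebra K G) (g : G) :
    innerRight K G c g = c * (1 - of K G g) := rfl

theorem innerRight_equivariant (g : G) (c : MonoidAlgebra K G) :
    innerRight K G (leftReg K G g c) = leftRegFun K G g (innerRight K G c) :=
  funext fun _ => mul_assoc _ _ _

end FoxValues

section Derivations

variable {K : Type u} {G : Type v} {M : Type*}
variable [CommRing K] [Group G] [AddCommGroup M] [Module K M] {ρ : Representation K G M}

theorem IsDerivation.add {d d' : G → M} (hd : IsDerivation ρ d) (hd' : IsDerivation ρ d') :
    IsDerivation ρ (d + d') := fun g h => by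
  simp only [Pi.add_apply, hd g h, hd' g h, map_add]; abel

theorem IsDerivation.sub {d d' : G → M} (hd : IsDerivation ρ d) (hd' : IsDerivation ρ d') :
    IsDerivation ρ (d - d') := fun g h => by
  simp only [Pi.sub_apply, hd g h, hd' g h, map_sub]; abel

theorem IsDerivation.smul {d : G → M} (r : K) (hd : IsDerivation ρ d) :
    IsDerivation ρ (r • d) := fun g h => by
  simp only [Pi.smul_apply, hd g h, map_smul, smul_add]

theorem IsDerivation.mul_right {d : G → MonoidAlgebra K G} (hd : IsDerivation (leftReg K G) d)
    (b : MonoidAlgebra K G) : IsDerivation (leftReg K G) fun g => d g * b := fun g h => by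
  simp only [hd g h, add_mul, leftReg_apply, mul_assoc]

theorem IsDerivationOn.sub {ι : Type*} {S : ι → Subgroup G} {d d' : G → M}
    (hd : IsDerivationOn S ρ d) (hd' : IsDerivationOn S ρ d') : IsDerivationOn S ρ (d - d') :=
  fun k s hs t ht => by
    simp only [Pi.sub_apply, hd k s hs t ht, hd' k s hs t ht, map_sub]; abel

theorem IsDerivationOn.smul {ι : Type*} {S : ι → Subgroup G} {d : G → M} (r : K)
    (hd : IsDerivationOn S ρ d) : IsDerivationOn S ρ (r • d) :=
  fun k s hs t ht => by
    simp only [Pi.smul_apply, hd k s hs t ht, map_smul, smul_add]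

theorem IsDerivationOn.mul_right {ι : Type*} {S : ι → Subgroup G} {d : G → MonoidAlgebra K G}
    (hd : IsDerivationOn S (leftReg K G) d) (b : MonoidAlgebra K G) :
    IsDerivationOn S (leftReg K G) fun g => d g * b :=
  fun k s hs t ht => by
    simp only [hd k s hs t ht, add_mul, leftReg_apply, mul_assoc]

/-- A derivation that vanishes at `x` vanishes on the powers of `x`. -/
theorem IsDerivation.eq_zero_of_mem_zpowers {d : G → M} (hd : IsDerivation ρ d) {x : G}
    (hx : d x = 0) {s : G} (hs : s ∈ Subgroup.zpowers x) : d s = 0 := by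
  let H : Subgroup G :=
    { carrier := {g | d g = 0}
      one_mem' := hd.map_one
      mul_mem' := fun {a b} ha hb => by
        rw [Set.mem_ofPred_eq] at *
        rw [hd, ha, hb, map_zero, add_zero]
      inv_mem' := fun {a} ha => by
        rw [Set.mem_ofPred_eq] at *
        have := hd a⁻¹ a
        rw [ha, map_zero, add_zero, inv_mul_cancel, hd.map_one] at this
        exact this.symm }
  exact (Subgroup.zpowers_le (H := H)).2 hx hs

end Derivations

/-! ### Construction of Fox pairings and the basis property -/

section Duality

variable {K : Type u} {G : Type v} [CommRing K] [Group G] {ι : Type*} {S : ι → Subgroup G}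
variable [Nonempty ι] {e : relCycles (Representation.trivial K G K) S 2}

theorem IsFundamentalClass.eq_of_mul_eq (he : IsFundamentalClass e) {c c' : MonoidAlgebra K G}
    (h : ∀ g, c * (1 - of K G g) = c' * (1 - of K G g)) : c = c' :=
  sub_eq_zero.1 <| he.eq_zero_of_mul fun g => by rw [sub_mul, h, sub_self]

theorem IsFundamentalClass.derivation_ext (he : IsFundamentalClass e)
    {d d' : G → MonoidAlgebra K G} (hd : IsDerivation (leftReg K G) d)
    (hd' : IsDerivation (leftReg K G) d') (h : ∀ k, ∀ s ∈ S k, d s = d' s) : d = d' :=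
  sub_eq_zero.1 <| he.derivation_eq_zero (hd.sub hd') fun k s hs => by
    rw [Pi.sub_apply, h k s hs, sub_self]

/-- A Fox pairing is determined by its values on `⋃ S_k × G`. -/
theorem IsFundamentalClass.foxPairing_ext (he : IsFundamentalClass e) {η η' : FoxPairing K G}
    (h : ∀ k, ∀ s ∈ S k, ∀ g, η.val s g = η'.val s g) : η = η' :=
  FoxPairing.ext_val fun g x => congrFun (he.derivation_ext (η.val_isDerivation x)
    (η'.val_isDerivation x) fun k s hs => h k s hs x) g

theorem IsFundamentalClass.exists_foxPairing (he : IsFundamentalClass e)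
    {a : G → MonoidAlgebra K G} (ha : IsDerivationOn S (leftReg K G) a) :
    ∃ η : FoxPairing K G, ∀ k, ∀ s ∈ S k, ∀ g, η.val s g = a s * (1 - of K G g) := by
  have hex : ∀ y : G, ∃ c, IsDerivation (leftReg K G) c ∧
      ∀ k, ∀ s ∈ S k, c s = a s * (1 - of K G y) := fun y => by
    refine (he.obstruction_eq_zero_iff (ha.mul_right _)).1 ?_
    rw [obstruction_mul, map_sub, map_one, aug_of, sub_self, mul_zero]
  choose c hc hca using hex
  -- Both sides are derivations in `g`, so it suffices to compare them on 𝒮, where 1 - yz = (1 - y)z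
  -- + (1 - z).
  have hr : ∀ g, (fun y => c y g) ∈ rightCocycles K G := fun g y z => by
    refine congrFun (he.derivation_ext (hc (y * z)) (((hc y).mul_right (of K G z)).add (hc z))
      fun k s hs => ?_) g
    rw [Pi.add_apply, hca _ k s hs, hca _ k s hs, hca _ k s hs, map_mul]
    noncomm_ring
  exact ⟨FoxPairing.ofVal (fun g y => c y g) hc hr, fun k s hs g =>
    (FoxPairing.ofVal_val _ hc hr s g).trans (hca g k s hs)⟩

theorem FoxPairing.cochain_eq (η : FoxPairing K G) :
    η.cochain = oneCochain K G _ fun g => Submodule.Quotient.mk ⟨η.val g, η.val_mem g⟩ := rfl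

theorem leftRep_mk (g : G) (f : rightCocycles K G) :
    leftRep K G g (Submodule.Quotient.mk f) = Submodule.Quotient.mk (leftMulCocycle g f) := rfl

theorem FoxPairing.cochain_mem {η : FoxPairing K G} {a : G → MonoidAlgebra K G}
    (hη : ∀ k, ∀ s ∈ S k, ∀ g, η.val s g = a s * (1 - of K G g)) :
    η.cochain ∈ relCocycles (leftRep K G) S 1 := by
  rw [FoxPairing.cochain_eq]
  refine ⟨oneCochain_mem_relCochains.2 fun k s hs => ?_,
    (cochainD_oneCochain_eq_zero_iff _ _).2 fun g h => ?_⟩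
  · exact (mk_rightH1_eq_zero_iff _).2 ⟨a s, fun g => (hη k s hs g).symm⟩
  · rw [leftRep_mk, ← Submodule.Quotient.mk_add]
    congr 1
    ext1
    funext x
    exact η.val_isDerivation x g h

/-- If r η(g, •) is inner, given by c(g), then c is a derivation of `G` extending r a, since inner
elements are unique. So r times the unit obstruction of `a` is zero. -/
theorem IsFundamentalClass.eq_zero_of_smul_cochain (he : IsFundamentalClass e)
    {η : FoxPairing K G} {a : G → MonoidAlgebra K G} (ha : IsDerivationOn S (leftReg K G) a)
    (hη : ∀ k, ∀ s ∈ S k, ∀ g, η.val s g = a s * (1 - of K G g))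
    (hu : IsUnit (obstruction e a)) {r : K} (hr : r • η.cochain = 0) : r = 0 := by
  have hex : ∀ g, ∃ c : MonoidAlgebra K G, ∀ x, c * (1 - of K G x) = r • η.val g x := fun g => by
    have := congrFun hr fun _ => g
    exact (mk_rightH1_eq_zero_iff (r • (⟨η.val g, η.val_mem g⟩ : rightCocycles K G))).1 this
  choose c hc using hex
  have hobs : obstruction e (r • a) = 0 := by
    refine (he.obstruction_eq_zero_iff (ha.smul r)).2 ⟨c, fun g h => ?_, fun k s hs => ?_⟩
    · refine he.eq_of_mul_eq fun x => ?_
      have : η.val (g * h) x = η.val g x + of K G g * η.val h x := η.val_isDerivation x g h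
      rw [leftReg_apply, hc, add_mul, mul_assoc, hc, hc, this, smul_add, mul_smul_comm]
    · refine he.eq_of_mul_eq fun x => ?_
      rw [hc, hη k s hs, Pi.smul_apply, smul_mul_assoc]
  rwa [map_smul, smul_eq_mul, hu.mul_left_eq_zero] at hobs

/-- This is the connecting homomorphism made explicit: the coboundary of a lift of `b` to right
cocycles is inner, given by a 2-cocycle `f` with values in K[G]. Comparing its obstruction with that
of `a` yields the scalar. -/
theorem IsFundamentalClass.exists_smul_cochain_eq (he : IsFundamentalClass e)
    {η : FoxPairing K G} {a : G → MonoidAlgebra K G} (ha : IsDerivationOn S (leftReg K G) a)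
    (hη : ∀ k, ∀ s ∈ S k, ∀ g, η.val s g = a s * (1 - of K G g))
    (hu : IsUnit (obstruction e a)) {b : G → RightH1 K G} (hb : IsDerivation (leftRep K G) b)
    (hbS : ∀ k, ∀ s ∈ S k, b s = 0) : ∃ r : K, r • η.cochain = oneCochain K G _ b := by
  -- The lift is chosen to vanish on 𝒮, so that `f` will be a relative cocycle.
  have hlift : ∀ g, ∃ z : rightCocycles K G, (Submodule.Quotient.mk z : RightH1 K G) = b g ∧
      ((∃ k, g ∈ S k) → z = 0) := fun g => by
    by_cases hg : ∃ k, g ∈ S k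
    · obtain ⟨k, hk⟩ := hg
      exact ⟨0, by rw [hbS k g hk]; rfl, fun _ => rfl⟩
    · obtain ⟨z, hz⟩ := Submodule.Quotient.mk_surjective _ (b g)
      exact ⟨z, hz, fun h => absurd h hg⟩
  choose ξ hξ hξS using hlift
  have hf : ∀ g : Fin 2 → G, ∃ c : MonoidAlgebra K G, ∀ x, c * (1 - of K G x) =
      of K G (g 0) * (ξ (g 1)).1 x - (ξ (g 0 * g 1)).1 x + (ξ (g 0)).1 x := fun g => by
    refine (mk_rightH1_eq_zero_iff (leftMulCocycle (g 0) (ξ (g 1)) - ξ (g 0 * g 1) + ξ (g 0))).1 ?_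
    rw [Submodule.Quotient.mk_add, Submodule.Quotient.mk_sub, ← leftRep_mk, hξ, hξ, hξ, hb]
    simp
  choose f hf using hf
  have hfD : (fun g => innerRight K G (f g)) =
      cochainD (leftRegFun K G) 1 (oneCochain K G _ fun g => (ξ g).1) := by
    funext g x
    rw [cochainD_oneCochain, innerRight_apply, hf]
    rfl
  have hf2 : cochainD (leftReg K G) 2 f = 0 := by
    funext g
    refine he.eq_zero_of_mul fun x => ?_
    have := cochainD_comp (innerRight K G) innerRight_equivariant 2 f
    rw [hfD, cochainD_two_comp_one] at this
    exact (congrFun (congrFun this g) x).symm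
  obtain ⟨a', rfl⟩ := he.exists_cochainD_eq _ hf2
  have ha' : IsDerivationOn S (leftReg K G) a' := by
    refine isDerivationOn_of_cochainD_mem fun k g hg => he.eq_zero_of_mul fun x => ?_
    rw [hf, hξS (g 0) ⟨k, hg 0⟩, hξS (g 1) ⟨k, hg 1⟩, hξS _ ⟨k, mul_mem (hg 0) (hg 1)⟩]
    simp
  obtain ⟨r, hr⟩ := hu.exists_left_inv
  -- The scalar t is the quotient of the obstructions of a' and a, so a' - t a extends to a
  -- derivation c of `G`.
  set t := obstruction e a' * r with ht
  obtain ⟨c, hc, hca⟩ := (he.obstruction_eq_zero_iff (ha'.sub (ha.smul t))).1 (by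
    rw [map_sub, map_smul, smul_eq_mul, ht, mul_assoc, hr, mul_one, sub_self])
  -- Subtracting a' removes the coboundary of ξ, so the sum is a derivation in g; on 𝒮 its terms
  -- cancel because c = a' - t a there. Hence ξ equals -t η up to inner terms.
  have hzero : ∀ x, (fun g => (ξ g).1 x - a' g * (1 - of K G x) + t • η.val g x +
      c g * (1 - of K G x)) = 0 := fun x => by
    have hdiff : IsDerivation (leftReg K G) fun g => (ξ g).1 x - a' g * (1 - of K G x) := by
      intro g h
      have h1 := hf ![g, h] x
      rw [cochainD_oneCochain] at h1
      simp only [Matrix.cons_val_zero, Matrix.cons_val_one, leftReg_apply, add_mul, sub_mul]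
        at h1 ⊢
      rw [← sub_eq_zero] at h1 ⊢
      rw [← h1]
      noncomm_ring
    refine he.derivation_eq_zero ((hdiff.add ((η.val_isDerivation x).smul t)).add
      (hc.mul_right _)) fun k s hs => ?_
    simp only [Pi.smul_apply, hca k s hs, hη k s hs, hξS s ⟨k, hs⟩, Pi.sub_apply,
      sub_mul, smul_mul_assoc]
    simp
  refine ⟨-t, ?_⟩
  rw [FoxPairing.cochain_eq, ← map_smul]
  congr 1
  funext g
  rw [Pi.smul_apply, ← hξ, ← Submodule.Quotient.mk_smul]
  refine (mk_rightH1_eq_iff _ _).2 ⟨c g - a' g, fun x => ?_⟩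
  have := congrFun (hzero x) g
  change _ = -t • η.val g x - (ξ g).1 x
  rw [Pi.zero_apply] at this
  rw [← sub_eq_zero, ← this, sub_mul, neg_smul]
  abel

theorem IsFundamentalClass.isFundamental (he : IsFundamentalClass e)
    {η : FoxPairing K G} {a : G → MonoidAlgebra K G} (ha : IsDerivationOn S (leftReg K G) a)
    (hη : ∀ k, ∀ s ∈ S k, ∀ g, η.val s g = a s * (1 - of K G g))
    (hu : IsUnit (obstruction e a)) : η.IsFundamental S := by
  refine ⟨FoxPairing.cochain_mem hη, ?_, ?_⟩
  · refine (injective_iff_map_eq_zero (LinearMap.toSpanSingleton K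
      (RelCohomology (leftRep K G) S 1) _)).2 fun r hr => ?_
    have := (Submodule.Quotient.mk_eq_zero
      ((relCoboundaries (leftRep K G) S 1).submoduleOf (relCocycles (leftRep K G) S 1))
      (x := r • (⟨η.cochain, FoxPairing.cochain_mem hη⟩ : relCocycles (leftRep K G) S 1))).1 hr
    rw [relCoboundaries_one] at this
    exact he.eq_zero_of_smul_cochain ha hη hu this
  · intro x
    obtain ⟨⟨F, hF⟩, rfl⟩ := Submodule.Quotient.mk_surjective _ x
    obtain ⟨b, rfl⟩ := oneCochain_surjective (K := K) F
    obtain ⟨r, hr⟩ := he.exists_smul_cochain_eq ha hη hu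
      ((cochainD_oneCochain_eq_zero_iff _ _).1 hF.2) (oneCochain_mem_relCochains.1 hF.1)
    exact ⟨r, congrArg Submodule.Quotient.mk (Subtype.ext hr)⟩

end Duality

/-! ### Infinite cyclic boundary -/

section CyclicSubgroup

variable {K : Type u} {G : Type v} [CommRing K] [Group G]

variable (K) in
/-- The affine bijection `x ↦ ζ x + 1` of `K[G]`. -/
def affinePerm (ζ : G) : Equiv.Perm (MonoidAlgebra K G) where
  toFun x := of K G ζ * x + 1
  invFun x := of K G ζ⁻¹ * (x - 1)
  left_inv x := by beta_reduce; rw [add_sub_cancel_right, ← mul_assoc, ← map_mul, inv_mul_cancel, map_one,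
    one_mul]
  right_inv x := by beta_reduce; rw [← mul_assoc, ← map_mul, mul_inv_cancel, map_one, one_mul, sub_add_cancel]

theorem affinePerm_apply (ζ : G) (x : MonoidAlgebra K G) :
    affinePerm K ζ x = of K G ζ * x + 1 := rfl

theorem affinePerm_inv_apply (ζ : G) (x : MonoidAlgebra K G) :
    (affinePerm K ζ)⁻¹ x = of K G ζ⁻¹ * (x - 1) := rfl

/-- The n-th power of the affine map has linear part ζⁿ. Consequently its constant term, as a
function of ζⁿ, obeys the derivation rule, for negative n as well. -/
theorem affinePerm_zpow_apply (ζ : G) (n : ℤ) (x : MonoidAlgebra K G) :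
    (affinePerm K ζ ^ n) x = of K G (ζ ^ n) * x + (affinePerm K ζ ^ n) 0 := by
  induction n generalizing x with
  | zero => rw [zpow_zero, zpow_zero, map_one, one_mul]; exact (add_zero x).symm
  | succ n ih =>
    rw [zpow_add_one, zpow_add_one, Equiv.Perm.mul_apply, Equiv.Perm.mul_apply,
      ih, ih (affinePerm K ζ 0), affinePerm_apply, affinePerm_apply, map_mul]
    noncomm_ring
  | pred n ih =>
    rw [zpow_sub_one, zpow_sub_one, Equiv.Perm.mul_apply, Equiv.Perm.mul_apply,
      ih, ih ((affinePerm K ζ)⁻¹ 0), affinePerm_inv_apply, affinePerm_inv_apply, map_mul]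
    noncomm_ring

/-- If `ζ` has infinite order, `⟨ζ⟩` has a derivation with values in `K[G]` that sends `ζ` to 1. -/
theorem exists_isDerivationOn_zpowers {ζ : G} (hζ : ¬ IsOfFinOrder ζ) :
    ∃ b : G → MonoidAlgebra K G, b ζ = 1 ∧ ∀ s ∈ Subgroup.zpowers ζ, ∀ t ∈ Subgroup.zpowers ζ,
      b (s * t) = b s + of K G s * b t := by
  -- Infinite order makes the value at ζⁿ well defined.
  have hinj : Function.Injective fun n : ℤ => ζ ^ n := injective_zpow_iff_not_isOfFinOrder.2 hζ
  let b : G → MonoidAlgebra K G :=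
    Function.extend (fun n : ℤ => ζ ^ n) (fun n => (affinePerm K ζ ^ n) 0) 0
  have hb : ∀ n : ℤ, b (ζ ^ n) = (affinePerm K ζ ^ n) 0 := fun n => hinj.extend_apply _ _ n
  refine ⟨b, ?_, ?_⟩
  · have := hb 1
    rwa [zpow_one, zpow_one, affinePerm_apply, mul_zero, zero_add] at this
  · rintro _ ⟨m, rfl⟩ _ ⟨n, rfl⟩
    change b (ζ ^ m * ζ ^ n) = b (ζ ^ m) + of K G (ζ ^ m) * b (ζ ^ n)
    rw [← zpow_add, hb, hb, hb, zpow_add, Equiv.Perm.mul_apply, affinePerm_zpow_apply ζ m, add_comm]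

variable {ι : Type*} {S : ι → Subgroup G} [Nonempty ι]
variable {e : relCycles (Representation.trivial K G K) S 2}

/-- An extension c of `b` would give a homomorphism aug ∘ c from `G` to K with value 1 at ζ. Its
multiples by d(ζ) would then extend every d that is a homomorphism on each `S_k`, against
`exists_not_extends`. -/
theorem IsFundamentalClass.obstruction_ne_zero [Nontrivial K] (he : IsFundamentalClass e) {ζ : G}
    (hle : ∀ k, S k ≤ Subgroup.zpowers ζ) {k₀ : ι} (hk₀ : ζ ∈ S k₀)
    {b : G → MonoidAlgebra K G} (hb : IsDerivationOn S (leftReg K G) b) (hbζ : b ζ = 1) :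
    obstruction e b ≠ 0 := by
  intro h0
  obtain ⟨c, hc, hcb⟩ := (he.obstruction_eq_zero_iff hb).1 h0
  obtain ⟨d, hd, hχ⟩ := he.exists_not_extends
  have hadd : ∀ g h, aug K G (c (g * h)) = aug K G (c g) + aug K G (c h) := fun g h => by
    rw [hc, map_add, leftReg_apply, map_mul, aug_of, one_mul]
  refine hχ (fun g => aug K G (c g) • d ζ) (fun g h => by simp only [hadd, add_smul])
    fun k s hs => ?_
  obtain ⟨n, rfl⟩ := hle k hs
  let φ : ℤ →+ MonoidAlgebra K G :=
    AddMonoidHom.mk' (fun n => aug K G (c (ζ ^ n)) • d ζ) fun m n => by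
      simp only [zpow_add, hadd, add_smul]
  let ψ : ℤ →+ MonoidAlgebra K G :=
    AddMonoidHom.mk' (fun n => d (ζ ^ n)) fun m n => by
      rw [zpow_add, hd k₀ _ (zpow_mem hk₀ m) _ (zpow_mem hk₀ n)]
  have : φ = ψ := AddMonoidHom.ext_int (by
    change aug K G (c (ζ ^ (1 : ℤ))) • d ζ = d (ζ ^ (1 : ℤ))
    rw [zpow_one, hcb k₀ ζ hk₀, hbζ, map_one, one_smul])
  exact DFunLike.congr_fun this n

end CyclicSubgroup

end FoxPD

end

/-! ### The main theorem -/

theorem theorem4p3 {K : Type u} {G : Type v} [CommRing K] [Group G] {m : ℕ} (hm : 0 < m)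
    (S : Fin m → Subgroup G) (hS : ∀ i j, i ≠ j → S i ⊓ S j = ⊥)
    (hPD : FoxPD.IsPoincareDualityPair K S 2) :
    (∃ η : FoxPD.FoxPairing K G,
      η.IsFundamental S ∧
      (∃! a : (⋃ k, (S k : Set G) : Set G) → MonoidAlgebra K G,
        ∀ (s : (⋃ k, (S k : Set G) : Set G)) (g : G),
          η.val s g = a s * (1 - MonoidAlgebra.of K G g)) ∧
      (∀ η' : FoxPD.FoxPairing K G,
        (∀ s ∈ ⋃ k, (S k : Set G), ∀ g : G, η'.val s g = η.val s g) → η' = η)) ∧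
    (IsField K → ∀ ζ : G, ¬ IsOfFinOrder ζ →
      (⋃ k, (S k : Set G)) = (Subgroup.zpowers ζ : Set G) →
      ∃ η : FoxPD.FoxPairing K G,
        η.IsFundamental S ∧
        (∀ g : G, η.val ζ g = 1 - MonoidAlgebra.of K G g) ∧
        (∀ η' : FoxPD.FoxPairing K G,
          (∀ g : G, η'.val ζ g = 1 - MonoidAlgebra.of K G g) → η' = η)) := by
  have : Nonempty (Fin m) := ⟨⟨0, hm⟩⟩
  obtain ⟨e, hall⟩ := hPD
  have he : FoxPD.IsFundamentalClass e := fun M _ _ ρ => (hall M ρ).1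
  refine ⟨?_, fun hK ζ hζ hU => ?_⟩
  · obtain ⟨a, ha, ha1⟩ := he.exists_obstruction_eq_one
    obtain ⟨η, hη⟩ := he.exists_foxPairing ha
    refine ⟨η, he.isFundamental ha hη (ha1 ▸ isUnit_one), ⟨fun s => a s, ?_, ?_⟩, ?_⟩
    · rintro ⟨s, hs⟩ g
      obtain ⟨k, hk⟩ := Set.mem_iUnion.1 hs
      exact hη k s hk g
    · intro a' ha'
      funext ⟨s, hs⟩
      obtain ⟨k, hk⟩ := Set.mem_iUnion.1 hs
      exact he.eq_of_mul_eq fun g => (ha' ⟨s, hs⟩ g).symm.trans (hη k s hk g)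
    · intro η' hη'
      exact he.foxPairing_ext fun k s hs => hη' s (Set.mem_iUnion.2 ⟨k, hs⟩)
  · have := hK.nontrivial
    have hle : ∀ k, S k ≤ Subgroup.zpowers ζ := fun k s hs => by
      rw [← SetLike.mem_coe, ← hU]
      exact Set.mem_iUnion.2 ⟨k, hs⟩
    -- The subgroup `S k₀` containing ζ is all of ⟨ζ⟩, and the other members of the family lie
    -- inside it.
    obtain ⟨k₀, hk₀⟩ : ∃ k, ζ ∈ S k := by
      have : ζ ∈ (⋃ k, (S k : Set G)) := hU ▸ Subgroup.mem_zpowers ζ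
      exact Set.mem_iUnion.1 this
    obtain ⟨b, hbζ, hb⟩ := FoxPD.exists_isDerivationOn_zpowers (K := K) hζ
    have hbS : FoxPD.IsDerivationOn S (FoxPD.leftReg K G) b :=
      fun k s hs t ht => hb s (hle k hs) t (hle k ht)
    obtain ⟨η, hη⟩ := he.exists_foxPairing hbS
    obtain ⟨r, hr⟩ := hK.mul_inv_cancel (he.obstruction_ne_zero hle hk₀ hbS hbζ)
    have hηζ : ∀ g : G, η.val ζ g = 1 - MonoidAlgebra.of K G g := fun g => by
      rw [hη k₀ ζ hk₀, hbζ, one_mul]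
    refine ⟨η, he.isFundamental hbS hη (IsUnit.of_mul_eq_one r hr), hηζ, fun η' hη' => ?_⟩
    -- For fixed g the difference of the two pairings is a derivation that vanishes at ζ, hence on
    -- ⟨ζ⟩.
    refine he.foxPairing_ext fun k s hs g => sub_eq_zero.1 ?_
    exact ((η'.val_isDerivation g).sub (η.val_isDerivation g)).eq_zero_of_mem_zpowers
      (sub_eq_zero.2 ((hη' g).trans (hηζ g).symm)) (hle k hs)
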